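/- Let $\mathbb S=\mathbb R/\mathbb Z$ be the circle with its arc-length metric $d$ and Lebesgue measure $\mathfrak m$. Let $(\Omega,\mathcal F,\eta)$ be a probability space and, for each $\omega\in\Omega$, let $T_\omega:\mathbb S\to\mathbb S$ be a $C^2$ map without critical points ($T_\omega'\neq 0$ everywhere), such that $(\omega,x)\mapsto T_\omega x$ is measurable. Put $$\lambda_\omega=\inf|T_\omega'|,\qquad \Delta_\omega=\left\|\frac{T_\omega''}{(T_\omega')^2}\right\|_\infty ,$$ and assume $$\int\lambda_\omega^{-2}\,d\eta(\omega)<1,\qquad \int\Delta_\omega^{2}\,d\eta(\omega)<\infty .$$ Define the operators $$\mathcal Q f(x)=\int_\Omega f(T_\omega x)\,d\eta(\omega),\qquad \mathcal P g(x)=\int_\Omega \sum_{y\in T_\omega^{-1}\{x\}}\frac{g(y)}{|T_\omega'(y)|}\,d\eta(\omega).$$ For $\alpha\in(0,1)$ let $C^\alpha$ be the set of $\alpha$-Hölder continuous functions on $\mathbb S$, let $|f|_\alpha$ be the Hölder constant of $f$ (the least $K$ with $|f(x)-f(y)|\le K\,d(x,y)^\alpha$ for all $x,y$), and let $\|f\|_\alpha=|f|_\alpha+\|f\|_\infty$.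 Then there is a probability measure $\mu$ on $\mathbb S$ that is stationary, i.e. $\int\mathcal Qf\,d\mu=\int f\,d\mu$ for all bounded measurable $f:\mathbb S\to\mathbb R$, and absolutely continuous with respect to $\mathfrak m$ with a density $\phi$ that is Lipschitz continuous and bounded away from zero, for which the following holds. There exist a constant $\theta\in(0,1)$ and, for any $\alpha\in(0,1)$, a constant $C>0$ such that $$\|\mathcal P^n\psi-\phi\|_{L^1(\mathfrak m)}\le C\,\|\psi\|_\alpha\,\theta^{\alpha n}$$ for all $n\ge 0$ and all probability densities $\psi\in C^\alpha$, and $$\left|\int f\cdot\mathcal Q^n g\,d\mu-\int f\,d\mu\int g\,d\mu\right|\le C\,\|f\|_\alpha\,\|g\|_\infty\,\theta^{\alpha n}$$ for all $n\ge 0$ and all complex-valued functions $f\in C^\alpha$ and $g\in L^\infty(\mathfrak m)$. -/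

import Mathlib

open MeasureTheory
open scoped NNReal ENNReal

noncomputable section

namespace RandomCircle

/-- A circle map `T` is `C²` if it has a `C²` lift `F : ℝ → ℝ` through the covering `ℝ → ℝ/ℤ`. -/
def IsC2 (T : UnitAddCircle → UnitAddCircle) : Prop :=
  ∃ F : ℝ → ℝ, ContDiff ℝ 2 F ∧ ∀ t : ℝ, ((F t : ℝ) : UnitAddCircle) = T (t : UnitAddCircle)

/-- The representative in `(-1/2, 1/2]` of a point of `ℝ/ℤ`. -/
def rep (x : UnitAddCircle) : ℝ := (AddCircle.equivIoc (1 : ℝ) (-1 / 2) x : ℝ)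

/-- The derivative at `x` of a real-valued function on the circle. -/
def scalarDeriv (h : UnitAddCircle → ℝ) (x : UnitAddCircle) : ℝ :=
  deriv (fun s : ℝ => h (x + (s : UnitAddCircle))) 0

/-- The derivative `T'(x)` of a circle map: for small real `s` the increment `T (x + s) - T x` is
read as a real number near `0`. It is the derivative of any lift, see `mapDeriv_coe`. -/
def mapDeriv (T : UnitAddCircle → UnitAddCircle) (x : UnitAddCircle) : ℝ :=
  deriv (fun s : ℝ => rep (T (x + (s : UnitAddCircle)) - T x)) 0

/-- The second derivative `T''` of a circle map. -/
def mapDeriv2 (T : UnitAddCircle → UnitAddCircle) : UnitAddCircle → ℝ :=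
  scalarDeriv (mapDeriv T)

theorem mapDeriv_coe {T : UnitAddCircle → UnitAddCircle} {F : ℝ → ℝ} (hF : Continuous F)
    (hT : ∀ t : ℝ, ((F t : ℝ) : UnitAddCircle) = T (t : UnitAddCircle)) (t : ℝ) :
    mapDeriv T (t : UnitAddCircle) = deriv F t := by
  have h1 : (fun s : ℝ => rep (T ((t : UnitAddCircle) + (s : UnitAddCircle)) - T t))
      =ᶠ[nhds 0] fun s => F (t + s) - F t := by
    have hc : Filter.Tendsto (fun s : ℝ => F (t + s) - F t) (nhds 0) (nhds 0) := by
      have : Continuous fun s : ℝ => F (t + s) - F t := by fun_prop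
      simpa using this.tendsto 0
    filter_upwards [hc.eventually (Ioo_mem_nhds (show (-1 / 2 : ℝ) < 0 by norm_num)
      (show (0 : ℝ) < 1 / 2 by norm_num))] with s hs
    rw [← AddCircle.coe_add, ← hT, ← hT, ← AddCircle.coe_sub]
    exact AddCircle.equivIoc_coe_of_mem ⟨hs.1, by linarith [hs.2]⟩
  rw [mapDeriv, h1.deriv_eq, deriv_sub_const, deriv_comp_const_add, add_zero]

/-- The dilation `λ = inf |T'|`. -/
def dilation (T : UnitAddCircle → UnitAddCircle) : ℝ := ⨅ x, |mapDeriv T x|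

/-- The distortion `Δ = ‖T'' / (T')²‖_∞`. -/
def distortion (T : UnitAddCircle → UnitAddCircle) : ℝ :=
  ⨆ x, |mapDeriv2 T x / mapDeriv T x ^ 2|

/-- The transfer operator `(𝓛 g)(x) = ∑_{T y = x} g y / |T' y|`. -/
def transfer (T : UnitAddCircle → UnitAddCircle) (g : UnitAddCircle → ℝ) (x : UnitAddCircle) : ℝ :=
  ∑ᶠ y ∈ T ⁻¹' {x}, g y / |mapDeriv T y|

variable {Ω : Type*} [MeasurableSpace Ω]

/-- The averaged transfer operator `(𝓟 g)(x) = ∫ (𝓛_ω g)(x) dη(ω)`. -/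
def avgTransfer (η : Measure Ω) (T : Ω → UnitAddCircle → UnitAddCircle)
    (g : UnitAddCircle → ℝ) (x : UnitAddCircle) : ℝ :=
  ∫ ω, transfer (T ω) g x ∂η

/-- The Markov operator `(𝓠 f)(x) = ∫ f (T_ω x) dη(ω)`, for real- or complex-valued `f`. -/
def markovOp {E : Type*} [NormedAddCommGroup E] [NormedSpace ℝ E] (η : Measure Ω)
    (T : Ω → UnitAddCircle → UnitAddCircle) (f : UnitAddCircle → E) (x : UnitAddCircle) : E :=
  ∫ ω, f (T ω x) ∂η

/-- `μ` is stationary: `∫ 𝓠 f dμ = ∫ f dμ` for all bounded measurable `f`. -/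
def IsStationary (η : Measure Ω) (T : Ω → UnitAddCircle → UnitAddCircle)
    (μ : Measure UnitAddCircle) : Prop :=
  ∀ f : UnitAddCircle → ℝ, Measurable f → (∃ M : ℝ, ∀ x, |f x| ≤ M) →
    ∫ x, markovOp η T f x ∂μ = ∫ x, f x ∂μ

/-- The norm `‖f‖_α = |f|_α + ‖f‖_∞` of an `α`-Hölder function on the circle. -/
def holderNorm {E : Type*} [NormedAddCommGroup E] (α : ℝ≥0) (f : UnitAddCircle → E) : ℝ :=
  (nnHolderNorm α f : ℝ) + ⨆ x, ‖f x‖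

end RandomCircle

end

/-! The averaged transfer operator `P` both regularizes densities and spreads mass; together the two
effects contract a class of Lipschitz densities.

For one map, the inverse of a lift has a derivative `v` with `|v'| ≤ D |v|`. As transfer preserves
integrals, this yields `transfer T 1 ≤ 1 + D` and sends a function with Lipschitz constant `K` and
sup norm `S` to one with constant `K l (1 + D) + S D (1 + D)` (`HasBounds.abs_transfer_sub_le`). The
averaged factor of `K` need not be below one, so iterates are used: composing independent maps
multiplies the `l` and replaces `D` by `D₂ + l₂ D₁`. Hence `E l²` decays geometrically while `E D²`
stays bounded (`SystemBounds.exists_iterate`), and the factor of `K` becomes small. Interpolating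
the sup norm between the Lipschitz constant and the `L¹` norm, some power `P ^ N` improves the
Lipschitz constant `A` of a density to `3 A / 4`.

Such a density is at least `1 / 2` on an arc of length `1 / (2 A)`, and with positive probability
the composed map expands this arc over the whole circle; so `P ^ N g ≥ c`
(`SystemBounds.exists_isDoeblin`). Removing the constant `c` and renormalizing stays in the class,
so two densities approach each other in `L¹` like `(1 - c) ^ k` (`IsDoeblin.integral_abs_sub_le`).
Completeness gives the invariant density. A Hölder function is replaced by a Lipschitz one at scale
`θ ^ n`, with error of order `θ ^ (α n)`, and correlations follow from the duality of `P` and `Q`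
applied to `f φ`. -/

noncomputable section

namespace RandomCircle

/-! ### Lifts, inverse lifts and fibres -/

/-- `T` has a `C²` lift `F` with `|F'|⁻¹ ≤ l`, `|F'' / F'²| ≤ D` and `|F'| ≤ M`. -/
def HasBounds (T : UnitAddCircle → UnitAddCircle) (l D M : ℝ) : Prop :=
  ∃ F : ℝ → ℝ, ContDiff ℝ 2 F ∧ (∀ t : ℝ, ((F t : ℝ) : UnitAddCircle) = T (t : UnitAddCircle)) ∧
    ∀ t, deriv F t ≠ 0 ∧ |deriv F t|⁻¹ ≤ l ∧ |deriv (deriv F) t| ≤ D * deriv F t ^ 2 ∧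
      |deriv F t| ≤ M

/-- `G` is a global inverse of a lift of degree `d` of `T`, with derivative `v`. -/
structure InverseLift (T : UnitAddCircle → UnitAddCircle) (l D : ℝ) (G v : ℝ → ℝ) (d : ℤ) :
    Prop where
  degree_ne_zero : d ≠ 0
  hasDerivAt : ∀ s, HasDerivAt G (v s) s
  injective : Function.Injective G
  surjective : Function.Surjective G
  add_mul : ∀ (s : ℝ) (j : ℤ), G (s + j * d) = G s + j
  fiber : ∀ s t : ℝ, T (t : UnitAddCircle) = (s : UnitAddCircle) ↔ ∃ m : ℤ, t = G (s + m)
  mapDeriv_eq : ∀ s, mapDeriv T ((G s : ℝ) : UnitAddCircle) = (v s)⁻¹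
  abs_le : ∀ s, |v s| ≤ l
  exists_deriv : ∃ v' : ℝ → ℝ, Continuous v' ∧ ∀ s, HasDerivAt v (v' s) s ∧ |v' s| ≤ D * |v s|

theorem coe_eq_coe_iff {a b : ℝ} :
    (a : UnitAddCircle) = (b : UnitAddCircle) ↔ ∃ m : ℤ, a = b + m := by
  rw [← sub_eq_zero, ← AddCircle.coe_sub, AddCircle.coe_eq_zero_iff]
  constructor
  · rintro ⟨n, hn⟩
    exact ⟨n, by simp at hn; linarith⟩
  · rintro ⟨m, hm⟩
    exact ⟨m, by simp [hm]⟩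

/-- `F'` descends to the circle, so it is periodic and `F (t + 1) - F t` is constant; this constant
is an integer because `F` lifts a circle map. -/
theorem exists_lift_add_one {T : UnitAddCircle → UnitAddCircle} {F : ℝ → ℝ}
    (hF : Differentiable ℝ F) (hT : ∀ t : ℝ, ((F t : ℝ) : UnitAddCircle) = T (t : UnitAddCircle)) :
    ∃ d : ℤ, ∀ (t : ℝ) (j : ℤ), F (t + j) = F t + j * d := by
  have hderiv : ∀ t, deriv F (t + 1) = deriv F t := fun t => by
    rw [← mapDeriv_coe hF.continuous hT, ← mapDeriv_coe hF.continuous hT]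
    congr 1
    exact coe_eq_coe_iff.2 ⟨1, by simp⟩
  have hconst := is_const_of_deriv_eq_zero (f := fun t => F (t + 1) - F t)
    (by fun_prop) (fun t => by
      rw [deriv_fun_sub (by fun_prop) (by fun_prop), deriv_comp_add_const, hderiv, sub_self])
  obtain ⟨d, hd⟩ : ∃ d : ℤ, F (0 + 1) = F 0 + d := by
    rw [← coe_eq_coe_iff, hT, hT]
    congr 1
    exact coe_eq_coe_iff.2 ⟨1, by simp⟩
  have hone : ∀ t, F (t + 1) = F t + d := fun t => by
    have := hconst t 0
    linarith
  refine ⟨d, fun t j => ?_⟩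
  induction j using Int.induction_on with
  | zero => simp
  | succ n ih =>
    have := hone (t + n)
    push_cast at ih ⊢
    rw [show t + (n + 1 : ℝ) = t + n + 1 by ring, this, ih]
    ring
  | pred n ih =>
    have := hone (t + (-n - 1))
    push_cast at ih ⊢
    rw [show t + (-n - 1 : ℝ) + 1 = t + -n by ring, ih] at this
    linarith

/-- A lift with nonvanishing derivative is injective by Rolle, which forces nonzero degree and hence
surjectivity. The inverse has `v = 1 / F'` and `v' = -F'' / F'³`, so the distortion bound is exactly
`|v'| ≤ D |v|`. -/
theorem HasBounds.exists_inverseLift {T : UnitAddCircle → UnitAddCircle} {l D M : ℝ}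
    (h : HasBounds T l D M) : ∃ G v d, InverseLift T l D G v d := by
  obtain ⟨F, hF, hT, hb⟩ := h
  have hdF : Differentiable ℝ F := hF.differentiable (by norm_num)
  have hF1 : ContDiff ℝ 1 (deriv F) := by
    have : ContDiff ℝ (1 + 1) F := by simpa [one_add_one_eq_two] using hF
    exact (contDiff_succ_iff_deriv.1 this).2.2
  have hdF1 : Differentiable ℝ (deriv F) := hF1.differentiable (by norm_num)
  have hF2 : Continuous (deriv (deriv F)) := hF1.continuous_deriv (by norm_num)
  obtain ⟨d, hd⟩ := exists_lift_add_one hdF hT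
  have hinj : Function.Injective F := by
    have key : ∀ a b, a < b → F a ≠ F b := fun a b hab hFab => by
      obtain ⟨c, -, hc⟩ := exists_deriv_eq_zero hab hdF.continuous.continuousOn hFab
      exact (hb c).1 hc
    intro a b hab
    rcases lt_trichotomy a b with h | h | h
    · exact absurd hab (key _ _ h)
    · exact h
    · exact absurd hab.symm (key _ _ h)
  have hd0 : d ≠ 0 := by
    rintro rfl
    have := hinj (a₁ := 1) (a₂ := 0) (by simpa using hd 0 1)
    norm_num at this
  have hsurj : Function.Surjective F := by
    intro c
    obtain ⟨n, hn⟩ := exists_nat_ge |c - F 0|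
    have hn' := abs_le.1 hn
    -- `F (± n d) = F 0 ± n d²`: using multiples of `d` makes the direction independent of the sign
    -- of `d`.
    have hd1 : (1 : ℝ) ≤ d * d := by
      have h1 : 0 < d * d := mul_self_pos.2 hd0
      exact_mod_cast (show (1 : ℤ) ≤ d * d by omega)
    have hnn : (n : ℝ) ≤ n * (d * d) := le_mul_of_one_le_right (Nat.cast_nonneg n) hd1
    have e1 := hd 0 (n * d)
    have e2 := hd 0 (-(n * d))
    push_cast at e1 e2
    exact mem_range_of_exists_le_of_exists_ge hdF.continuous
      ⟨_, (e2.trans_le (by nlinarith))⟩ ⟨_, (e1.symm.le.trans' (by nlinarith))⟩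
  have hopen : IsOpenMap F := isOpenMap_of_hasStrictDerivAt (f' := deriv F)
    (fun x => (hF.contDiffAt.hasStrictDerivAt (by norm_num))) (fun x => (hb x).1)
  let e := (Equiv.ofBijective F ⟨hinj, hsurj⟩).toHomeomorphOfContinuousOpen hdF.continuous hopen
  have hFG : ∀ s, F (e.symm s) = s := fun s => e.apply_symm_apply s
  have hGF : ∀ t, e.symm (F t) = t := fun t => e.symm_apply_apply t
  have hG : ∀ s, HasDerivAt (fun s => e.symm s) (deriv F (e.symm s))⁻¹ s := fun s =>
    HasDerivAt.of_local_left_inverse e.symm.continuous.continuousAt (hdF _).hasDerivAt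
      (hb _).1 (Filter.Eventually.of_forall hFG)
  refine ⟨fun s => e.symm s, fun s => (deriv F (e.symm s))⁻¹, d, hd0, hG, e.symm.injective,
    e.symm.surjective, fun s j => ?_, fun s t => ?_, fun s => ?_, fun s => ?_,
    fun s => -(deriv (deriv F) (e.symm s) * (deriv F (e.symm s))⁻¹) / (deriv F (e.symm s)) ^ 2,
    ?_, fun s => ⟨?_, ?_⟩⟩
  · rw [← hGF (e.symm s + j), hd, hFG]
  · rw [← hT, coe_eq_coe_iff]
    refine exists_congr fun m => ⟨fun h => ?_, fun h => ?_⟩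
    · rw [← h, hGF]
    · rw [h, hFG]
  · rw [inv_inv, mapDeriv_coe hdF.continuous hT]
  · rw [abs_inv]
    exact (hb _).2.1
  · have hc : Continuous fun s => e.symm s := e.symm.continuous
    exact ((hF2.comp hc).mul ((hF1.continuous.comp hc).inv₀ fun s => (hb _).1)).neg.div
      ((hF1.continuous.comp hc).pow 2) fun s => pow_ne_zero 2 (hb _).1
  · exact ((hdF1 _).hasDerivAt.comp s (hG s)).inv (hb _).1
  · have h0 := (hb (e.symm s)).1
    have h2 := (hb (e.symm s)).2.2.1
    have hpos : 0 < deriv F (e.symm s) ^ 2 := by positivity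
    rw [abs_div, abs_neg, abs_mul, abs_of_pos hpos, div_le_iff₀ hpos]
    calc _ ≤ D * deriv F (e.symm s) ^ 2 * |(deriv F (e.symm s))⁻¹| := by gcongr
      _ = _ := by ring

namespace InverseLift

variable {T : UnitAddCircle → UnitAddCircle} {l D : ℝ} {G v : ℝ → ℝ} {d : ℤ}

theorem continuous (h : InverseLift T l D G v d) : Continuous G :=
  continuous_iff_continuousAt.2 fun s => (h.hasDerivAt s).continuousAt

theorem continuous_deriv (h : InverseLift T l D G v d) : Continuous v := by
  obtain ⟨v', -, h'⟩ := h.exists_deriv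
  exact continuous_iff_continuousAt.2 fun s => (h' s).1.continuousAt

theorem natAbs_pos (h : InverseLift T l D G v d) : 0 < d.natAbs :=
  Int.natAbs_pos.2 h.degree_ne_zero

theorem coe_add_mul_natAbs (h : InverseLift T l D G v d) (s : ℝ) (j : ℤ) :
    ((G (s + j * d.natAbs) : ℝ) : UnitAddCircle) = (G s : ℝ) := by
  rw [coe_eq_coe_iff]
  rcases Int.natAbs_eq d with hd | hd
  · refine ⟨j, ?_⟩
    rw [← h.add_mul]
    have hd' := congrArg (Int.cast : ℤ → ℝ) hd
    rw [Int.cast_natCast] at hd'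
    rw [hd']
  · refine ⟨-j, ?_⟩
    rw [← h.add_mul]
    congr 2
    have hd' := congrArg (Int.cast : ℤ → ℝ) hd
    rw [Int.cast_neg, Int.cast_natCast] at hd'
    rw [hd']
    push_cast
    ring

theorem preimage_eq (h : InverseLift T l D G v d) (s : ℝ) :
    T ⁻¹' {(s : UnitAddCircle)} =
      ((Finset.range d.natAbs).image fun k : ℕ => ((G (s + k) : ℝ) : UnitAddCircle) :
        Finset UnitAddCircle) := by
  have hN : (0 : ℤ) < d.natAbs := by exact_mod_cast h.natAbs_pos
  ext y
  obtain ⟨t, rfl⟩ := QuotientAddGroup.mk_surjective y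
  simp only [Set.mem_preimage, Set.mem_singleton_iff, Finset.coe_image, Finset.coe_range,
    Set.mem_image, Set.mem_Iio]
  refine (h.fiber s t).trans ⟨?_, ?_⟩
  · rintro ⟨m, rfl⟩
    have hm0 := Int.emod_nonneg m hN.ne'
    refine ⟨(m % d.natAbs).toNat, by have := Int.emod_lt_of_pos m hN; omega, ?_⟩
    rw [← h.coe_add_mul_natAbs _ (m / d.natAbs)]
    congr 2
    have e1 : (((m % d.natAbs).toNat : ℤ) : ℝ) = ((m % d.natAbs : ℤ) : ℝ) := by
      rw [Int.toNat_of_nonneg hm0]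
    have e2 : ((m % d.natAbs : ℤ) : ℝ) + ((m / d.natAbs : ℤ) : ℝ) * (d.natAbs : ℤ) = m := by
      have := Int.emod_add_mul_ediv m d.natAbs
      rw [mul_comm] at this
      rw [← Int.cast_mul, ← Int.cast_add, this]
    rw [Int.cast_natCast] at e1 e2
    rw [e1]
    linarith
  · rintro ⟨k, -, hk⟩
    obtain ⟨j, hj⟩ := coe_eq_coe_iff.1 hk.symm
    refine ⟨k + j * d, ?_⟩
    rw [hj, ← h.add_mul]
    push_cast
    congr 1
    ring

theorem injOn_coe (h : InverseLift T l D G v d) (s : ℝ) :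
    Set.InjOn (fun k : ℕ => ((G (s + k) : ℝ) : UnitAddCircle)) (Finset.range d.natAbs) := by
  intro k hk k' hk' hkk
  simp only [Finset.coe_range, Set.mem_Iio] at hk hk'
  obtain ⟨j, hj⟩ := coe_eq_coe_iff.1 hkk
  rw [← h.add_mul] at hj
  have h1 : (k : ℤ) = k' + j * d := by
    have := h.injective hj
    have h2 : (k : ℝ) = k' + j * d := by linarith
    exact_mod_cast h2
  have h3 : (k : ℤ) % d = k' % d := by rw [h1]; simp
  have h4 : d ∣ (k : ℤ) - k' := Int.ModEq.dvd (Eq.symm h3)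
  have h5 := Int.eq_zero_of_abs_lt_dvd (m := d.natAbs) (x := (k : ℤ) - k')
    (by simpa using h4) (by rw [abs_lt]; omega)
  omega

/-- All branches are integer translates of the single function `G`, so later estimates on `transfer`
never choose local inverses. -/
theorem transfer_coe (h : InverseLift T l D G v d) (g : UnitAddCircle → ℝ) (s : ℝ) :
    transfer T g (s : UnitAddCircle) =
      ∑ k ∈ Finset.range d.natAbs, g ((G (s + k) : ℝ) : UnitAddCircle) * |v (s + k)| := by
  rw [transfer, h.preimage_eq, finsum_mem_coe_finset, Finset.sum_image (h.injOn_coe s)]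
  refine Finset.sum_congr rfl fun k _ => ?_
  rw [h.mapDeriv_eq, abs_inv, div_inv_eq_mul]

/-- Shifting `G s` by `n` amounts to shifting `s` by `n d`, so `G` carries a period interval for `d`
to one for `1`. -/
theorem isAddFundamentalDomain (h : InverseLift T l D G v d) :
    IsAddFundamentalDomain (AddSubgroup.zmultiples (1 : ℝ)) (G '' Set.Ioc 0 (d.natAbs : ℝ)) := by
  have hN : (0 : ℝ) < d.natAbs := by exact_mod_cast h.natAbs_pos
  refine IsAddFundamentalDomain.mk'
    (MeasurableSet.nullMeasurableSet
      (measurableSet_Ioc.image_of_continuousOn_injOn h.continuous.continuousOn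
        h.injective.injOn)) fun x => ?_
  have hbij : Function.Bijective
      (Set.codRestrict (fun n : ℤ => n • (1 : ℝ)) (AddSubgroup.zmultiples (1 : ℝ))
        (fun n => ⟨n, rfl⟩)) :=
    (Equiv.ofInjective (fun n : ℤ => n • (1 : ℝ)) (zsmul_left_strictMono one_pos).injective).bijective
  refine hbij.existsUnique_iff.2 ?_
  obtain ⟨s, rfl⟩ := h.surjective x
  have key : ∀ n : ℤ, (G s + n ∈ G '' Set.Ioc 0 (d.natAbs : ℝ)) ↔
      s + n * d ∈ Set.Ioc 0 (d.natAbs : ℝ) := fun n => by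
    rw [← h.add_mul, h.injective.mem_set_image]
  have huniq := existsUnique_add_zsmul_mem_Ioc hN s 0
  simp only [zero_add, zsmul_eq_mul] at huniq
  have hgoal : ∃! n : ℤ, s + n * d ∈ Set.Ioc 0 (d.natAbs : ℝ) := by
    rcases Int.natAbs_eq d with hd | hd
    · have hd' := congrArg (Int.cast : ℤ → ℝ) hd
      rw [Int.cast_natCast] at hd'
      rw [hd']
      exact huniq
    · have hd' := congrArg (Int.cast : ℤ → ℝ) hd
      rw [Int.cast_neg, Int.cast_natCast] at hd'
      obtain ⟨n, hn, hn'⟩ := huniq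
      rw [hd']
      refine ⟨-n, ?_, fun m hm => ?_⟩
      · simpa using hn
      · have := hn' (-m) (by simpa using hm)
        omega
  refine (existsUnique_congr fun n => ?_).2 hgoal
  rw [← key]
  simp [Set.codRestrict, AddSubgroup.vadd_def, add_comm]

end InverseLift

/-! ### Change of variables and basic properties of the transfer operator -/

theorem sum_setLIntegral_comp_add (U : ℝ → ℝ≥0∞) (N : ℕ) :
    ∑ k ∈ Finset.range N, ∫⁻ s in Set.Ioc (0 : ℝ) (0 + 1), U (s + k) =
      ∫⁻ s in Set.Ioc (0 : ℝ) N, U s := by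
  induction N with
  | zero => simp
  | succ n ih =>
    have hshift : ∫⁻ s in Set.Ioc (0 : ℝ) (0 + 1), U (s + n) =
        ∫⁻ s in Set.Ioc (n : ℝ) (n + 1), U s := by
      have := (measurePreserving_add_right (volume : Measure ℝ) (n : ℝ)).setLIntegral_comp_preimage_emb
        (measurableEmbedding_addRight _) U (Set.Ioc (n : ℝ) (n + 1))
      rw [← this]
      simp
    rw [Finset.sum_range_succ, ih, hshift, ← lintegral_union measurableSet_Ioc
      (Set.Ioc_disjoint_Ioc_of_le le_rfl), Set.Ioc_union_Ioc_eq_Ioc (by positivity) (by simp)]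
    push_cast
    rfl

/-- Over `(0, 1]` the branches glue to a single integral over `(0, |d|]`; substituting `y = G s`
turns it into an integral over a fundamental domain, that is, over the circle. -/
theorem HasBounds.lintegral_transfer {T : UnitAddCircle → UnitAddCircle} {l D M : ℝ}
    (h : HasBounds T l D M) {f : UnitAddCircle → ℝ≥0∞} (hf : Measurable f)
    {g : UnitAddCircle → ℝ} (hg : Measurable g) (hg0 : ∀ x, 0 ≤ g x) :
    ∫⁻ x, f x * ENNReal.ofReal (transfer T g x) = ∫⁻ x, f (T x) * ENNReal.ofReal (g x) := by
  obtain ⟨G, v, d, hG⟩ := h.exists_inverseLift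
  have hGm : Measurable G := hG.continuous.measurable
  have hvm : Measurable v := hG.continuous_deriv.measurable
  have hcoe : Measurable ((↑) : ℝ → UnitAddCircle) := AddCircle.measurable_mk'
  set U : ℝ → ℝ≥0∞ := fun s => ENNReal.ofReal |v s| *
    (f (s : UnitAddCircle) * ENNReal.ofReal (g ((G s : ℝ) : UnitAddCircle))) with hU
  have hUm : Measurable U := by
    refine (hvm.abs.ennreal_ofReal).mul ((hf.comp hcoe).mul ?_)
    exact (hg.comp (hcoe.comp hGm)).ennreal_ofReal
  have h1 : ∀ s : ℝ, f (s : UnitAddCircle) * ENNReal.ofReal (transfer T g (s : UnitAddCircle)) =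
      ∑ k ∈ Finset.range d.natAbs, U (s + k) := fun s => by
    rw [hG.transfer_coe, ENNReal.ofReal_sum_of_nonneg
      (fun k _ => mul_nonneg (hg0 _) (abs_nonneg _)), Finset.mul_sum]
    refine Finset.sum_congr rfl fun k _ => ?_
    have : ((s + k : ℝ) : UnitAddCircle) = (s : UnitAddCircle) :=
      coe_eq_coe_iff.2 ⟨k, by simp⟩
    rw [hU]
    simp only [this]
    rw [ENNReal.ofReal_mul (hg0 _)]
    ring
  rw [← UnitAddCircle.lintegral_preimage 0, ← UnitAddCircle.lintegral_preimage 0]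
  simp_rw [h1]
  rw [lintegral_finsetSum _ (fun (k : ℕ) _ => show Measurable fun s : ℝ => U (s + k) by fun_prop),
    sum_setLIntegral_comp_add]
  have h2 := lintegral_image_eq_lintegral_abs_deriv_mul (measurableSet_Ioc (a := (0 : ℝ))
    (b := d.natAbs)) (fun x _ => (hG.hasDerivAt x).hasDerivWithinAt) hG.injective.injOn
    (fun t => f (T (t : UnitAddCircle)) * ENNReal.ofReal (g (t : UnitAddCircle)))
  have h3 : ∀ s : ℝ, T ((G s : ℝ) : UnitAddCircle) = (s : UnitAddCircle) := fun s =>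
    (hG.fiber s _).2 ⟨0, by simp⟩
  simp only [h3] at h2
  rw [← h2]
  refine hG.isAddFundamentalDomain.setLIntegral_eq (isAddFundamentalDomain_Ioc one_pos 0 volume)
    _ ?_
  rintro ⟨_, n, rfl⟩ x
  have : (((n • (1 : ℝ)) + x : ℝ) : UnitAddCircle) = (x : UnitAddCircle) :=
    coe_eq_coe_iff.2 ⟨n, by simp [add_comm]⟩
  simp only [AddSubgroup.vadd_def, vadd_eq_add, this]

theorem HasBounds.nonneg {T : UnitAddCircle → UnitAddCircle} {l D M : ℝ}
    (h : HasBounds T l D M) : 0 < l ∧ 0 ≤ D ∧ 0 < M := by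
  obtain ⟨F, -, -, hb⟩ := h
  obtain ⟨h0, h1, h2, h3⟩ := hb 0
  have hp : 0 < |deriv F 0| := abs_pos.2 h0
  refine ⟨(inv_pos.2 hp).trans_le h1, ?_, hp.trans_le h3⟩
  by_contra! hD
  have : 0 < deriv F 0 ^ 2 := by positivity
  nlinarith [abs_nonneg (deriv (deriv F) 0)]

theorem HasBounds.continuous_transfer {T : UnitAddCircle → UnitAddCircle} {l D M : ℝ}
    (h : HasBounds T l D M) {g : UnitAddCircle → ℝ} (hg : Continuous g) :
    Continuous (transfer T g) := by
  obtain ⟨G, v, d, hG⟩ := h.exists_inverseLift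
  refine (QuotientAddGroup.isQuotientMap_mk (N := AddSubgroup.zmultiples (1 : ℝ))).continuous_iff.2 ?_
  have : (transfer T g ∘ (QuotientAddGroup.mk : ℝ → UnitAddCircle)) = fun s =>
      ∑ k ∈ Finset.range d.natAbs, g ((G (s + k) : ℝ) : UnitAddCircle) * |v (s + k)| :=
    funext fun t => hG.transfer_coe g t
  rw [this]
  have h1 := hG.continuous
  have h2 := hG.continuous_deriv
  have h3 : Continuous ((↑) : ℝ → UnitAddCircle) := AddCircle.continuous_mk' 1
  fun_prop

theorem HasBounds.finite_preimage {T : UnitAddCircle → UnitAddCircle} {l D M : ℝ}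
    (h : HasBounds T l D M) (x : UnitAddCircle) : (T ⁻¹' {x}).Finite := by
  obtain ⟨G, v, d, hG⟩ := h.exists_inverseLift
  obtain ⟨s, rfl⟩ := QuotientAddGroup.mk_surjective x
  have := hG.preimage_eq s
  exact this ▸ Finset.finite_toSet _

theorem HasBounds.transfer_eq_sum {T : UnitAddCircle → UnitAddCircle} {l D M : ℝ}
    (h : HasBounds T l D M) (g : UnitAddCircle → ℝ) (x : UnitAddCircle) :
    transfer T g x = ∑ y ∈ (h.finite_preimage x).toFinset, g y / |mapDeriv T y| :=
  finsum_mem_eq_finite_toFinset_sum _ _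

/-! ### Distortion, sup, Lipschitz and lower bounds for one map -/

theorem InverseLift.abs_sub_le {T : UnitAddCircle → UnitAddCircle} {l D : ℝ} {G v : ℝ → ℝ} {d : ℤ}
    (h : InverseLift T l D G v d) {s t : ℝ} (hst : s ≤ t) :
    |v t - v s| ≤ D * ∫ u in s..t, |v u| := by
  obtain ⟨v', hc, hv⟩ := h.exists_deriv
  rw [← intervalIntegral.integral_eq_sub_of_hasDerivAt (fun u _ => (hv u).1)
    (hc.intervalIntegrable _ _), ← intervalIntegral.integral_const_mul]
  exact intervalIntegral.norm_integral_le_of_norm_le (f := v') (g := fun u => D * |v u|) hst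
    (Filter.Eventually.of_forall fun u _ => (hv u).2)
    (Continuous.intervalIntegrable (by have := h.continuous_deriv; fun_prop) _ _)

theorem InverseLift.sum_abs_sub_le {T : UnitAddCircle → UnitAddCircle} {l D : ℝ} {G v : ℝ → ℝ}
    {d : ℤ} (h : InverseLift T l D G v d) {s t : ℝ} (hst : s ≤ t) :
    ∑ k ∈ Finset.range d.natAbs, |v (t + k) - v (s + k)| ≤
      D * ∫ u in s..t, transfer T (fun _ => 1) (u : UnitAddCircle) := by
  have hv := h.continuous_deriv
  simp_rw [h.transfer_coe, one_mul]
  rw [intervalIntegral.integral_finsetSum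
    (fun k _ => (Continuous.intervalIntegrable (by fun_prop) _ _)), Finset.mul_sum]
  refine Finset.sum_le_sum fun k _ => ?_
  have := h.abs_sub_le (add_le_add_left hst (k : ℝ))
  rwa [← intervalIntegral.integral_comp_add_right] at this

theorem HasBounds.transfer_nonneg {T : UnitAddCircle → UnitAddCircle} {l D M : ℝ}
    (h : HasBounds T l D M) {g : UnitAddCircle → ℝ} (hg : ∀ x, 0 ≤ g x) (x : UnitAddCircle) :
    0 ≤ transfer T g x := by
  rw [h.transfer_eq_sum]
  exact Finset.sum_nonneg fun y _ => div_nonneg (hg y) (abs_nonneg _)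

theorem HasBounds.integral_transfer_one {T : UnitAddCircle → UnitAddCircle} {l D M : ℝ}
    (h : HasBounds T l D M) (s : ℝ) :
    ∫ u in s..(s + 1), transfer T (fun _ => 1) (u : UnitAddCircle) = 1 := by
  have hd := h.lintegral_transfer (f := fun _ => 1) measurable_const (g := fun _ => 1)
    measurable_const (fun _ => zero_le_one)
  simp only [one_mul, ENNReal.ofReal_one, lintegral_const, AddCircle.measure_univ] at hd
  have hc : Continuous fun u : ℝ => transfer T (fun _ => 1) (u : UnitAddCircle) :=
    (h.continuous_transfer continuous_const).comp (AddCircle.continuous_mk' 1)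
  rw [intervalIntegral.integral_of_le (by linarith), integral_eq_lintegral_of_nonneg_ae
    (Filter.Eventually.of_forall fun u => h.transfer_nonneg (fun _ => zero_le_one) _)
    hc.aestronglyMeasurable,
    UnitAddCircle.lintegral_preimage s (fun x => ENNReal.ofReal (transfer T (fun _ => 1) x)), hd]
  simp

/-- The image of `1` has mean one, and within a period it varies by at most `D` times its own mass;
so no value exceeds the mean by more than `D`. -/
theorem HasBounds.transfer_one_le {T : UnitAddCircle → UnitAddCircle} {l D M : ℝ}
    (h : HasBounds T l D M) (x : UnitAddCircle) : transfer T (fun _ => 1) x ≤ 1 + D := by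
  obtain ⟨G, v, d, hG⟩ := h.exists_inverseLift
  obtain ⟨s, rfl⟩ := QuotientAddGroup.mk_surjective x
  set W : ℝ → ℝ := fun u => transfer T (fun _ => 1) (u : UnitAddCircle) with hW
  have hWc : Continuous W :=
    (h.continuous_transfer continuous_const).comp (AddCircle.continuous_mk' 1)
  have hD := h.nonneg.2.1
  have hW0 : ∀ u, 0 ≤ W u := fun u => h.transfer_nonneg (fun _ => zero_le_one) _
  have hint : ∫ u in (s - 1)..s, W u = 1 := by
    have := h.integral_transfer_one (s - 1)
    rwa [sub_add_cancel] at this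
  have key : ∀ t ∈ Set.Icc (s - 1) s, W s - D ≤ W t := fun t ht => by
    have h1 := hG.sum_abs_sub_le ht.2
    have h2 : W s - W t ≤ ∑ k ∈ Finset.range d.natAbs, |v (s + k) - v (t + k)| := by
      simp only [hW, hG.transfer_coe, one_mul]
      rw [← Finset.sum_sub_distrib]
      exact Finset.sum_le_sum fun k _ => abs_sub_abs_le_abs_sub _ _
    have h3 : ∫ u in t..s, W u ≤ 1 := by
      rw [← hint]
      exact intervalIntegral.integral_mono_interval ht.1 ht.2 le_rfl
        (Filter.Eventually.of_forall hW0) (hWc.intervalIntegrable _ _)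
    have h4 : D * ∫ u in t..s, W u ≤ D := mul_le_of_le_one_right hD h3
    linarith
  have := intervalIntegral.integral_mono_on (μ := volume) (a := s - 1) (b := s) (by linarith)
    intervalIntegrable_const (hWc.intervalIntegrable _ _) key
  rw [hint] at this
  simp at this
  change W s ≤ _
  linarith

theorem HasBounds.abs_transfer_le {T : UnitAddCircle → UnitAddCircle} {l D M : ℝ}
    (h : HasBounds T l D M) {g : UnitAddCircle → ℝ} {S : ℝ} (hg : ∀ y, |g y| ≤ S)
    (x : UnitAddCircle) : |transfer T g x| ≤ S * (1 + D) := by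
  have hS : 0 ≤ S := (abs_nonneg _).trans (hg 0)
  refine le_trans ?_ (mul_le_mul_of_nonneg_left (h.transfer_one_le x) hS)
  rw [h.transfer_eq_sum, h.transfer_eq_sum, Finset.mul_sum]
  refine (Finset.abs_sum_le_sum_abs _ _).trans (Finset.sum_le_sum fun y _ => ?_)
  rw [abs_div, abs_abs, ← mul_div_assoc, mul_one]
  exact div_le_div_of_nonneg_right (hg y) (abs_nonneg _)

theorem exists_lift_dist (x y : UnitAddCircle) :
    ∃ s t : ℝ, (s : UnitAddCircle) = x ∧ (t : UnitAddCircle) = y ∧ |s - t| = dist x y := by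
  obtain ⟨a, rfl⟩ := QuotientAddGroup.mk_surjective x
  obtain ⟨b, rfl⟩ := QuotientAddGroup.mk_surjective y
  refine ⟨a, b + round (a - b), rfl, coe_eq_coe_iff.2 ⟨round (a - b), rfl⟩, ?_⟩
  have h : dist (a : UnitAddCircle) (b : UnitAddCircle) = ‖((a - b : ℝ) : UnitAddCircle)‖ := by
    rw [dist_eq_norm, AddCircle.coe_sub]
  rw [show dist (QuotientAddGroup.mk a : UnitAddCircle) (QuotientAddGroup.mk b) = _ from h,
    UnitAddCircle.norm_eq, sub_sub]

theorem dist_coe_le (s t : ℝ) : dist (s : UnitAddCircle) (t : UnitAddCircle) ≤ |s - t| := by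
  rw [dist_eq_norm, ← AddCircle.coe_sub, UnitAddCircle.norm_eq]
  simpa using round_le (s - t) 0

theorem InverseLift.abs_image_sub_le {T : UnitAddCircle → UnitAddCircle} {l D : ℝ} {G v : ℝ → ℝ}
    {d : ℤ} (h : InverseLift T l D G v d) (s t : ℝ) : |G t - G s| ≤ l * |t - s| := by
  simpa using Convex.norm_image_sub_le_of_norm_hasDerivWithin_le
    (fun x _ => (h.hasDerivAt x).hasDerivWithinAt) (fun x _ => h.abs_le x) convex_univ
    (Set.mem_univ s) (Set.mem_univ t)

/-- Moving along a branch changes `g` by at most `K l |t - s|` and changes the weight `|v|` by the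
distortion; both errors are summed against the bound `1 + D` on the image of `1`. -/
theorem HasBounds.abs_transfer_sub_le {T : UnitAddCircle → UnitAddCircle} {l D M : ℝ}
    (h : HasBounds T l D M) {g : UnitAddCircle → ℝ} {K S : ℝ} (hg : ∀ y, |g y| ≤ S) (hK : 0 ≤ K)
    (hL : ∀ x y, |g x - g y| ≤ K * dist x y) (x y : UnitAddCircle) :
    |transfer T g x - transfer T g y| ≤
      (K * (l * (1 + D)) + S * (D * (1 + D))) * dist x y := by
  obtain ⟨G, v, d, hG⟩ := h.exists_inverseLift
  have hS : 0 ≤ S := (abs_nonneg _).trans (hg 0)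
  obtain ⟨hl, hD, -⟩ := h.nonneg
  have key : ∀ s t : ℝ, s ≤ t →
      |transfer T g (t : UnitAddCircle) - transfer T g (s : UnitAddCircle)| ≤
        (K * (l * (1 + D)) + S * (D * (1 + D))) * (t - s) := fun s t hst => by
    have h1 : |transfer T g (t : UnitAddCircle) - transfer T g (s : UnitAddCircle)| ≤
        ∑ k ∈ Finset.range d.natAbs,
          (K * (l * (t - s)) * |v (t + k)| + S * |v (t + k) - v (s + k)|) := by
      rw [hG.transfer_coe, hG.transfer_coe, ← Finset.sum_sub_distrib]
      refine (Finset.abs_sum_le_sum_abs _ _).trans (Finset.sum_le_sum fun k _ => ?_)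
      set a := g ((G (t + k) : ℝ) : UnitAddCircle)
      set b := g ((G (s + k) : ℝ) : UnitAddCircle)
      have hab : |a - b| ≤ K * (l * (t - s)) := by
        refine (hL _ _).trans (mul_le_mul_of_nonneg_left ?_ hK)
        refine (dist_coe_le _ _).trans ((hG.abs_image_sub_le _ _).trans_eq ?_)
        rw [add_sub_add_right_eq_sub, abs_of_nonneg (by linarith)]
      have e : a * |v (t + k)| - b * |v (s + k)| =
          (a - b) * |v (t + k)| + b * (|v (t + k)| - |v (s + k)|) := by ring
      rw [e]
      refine (abs_add_le _ _).trans (add_le_add ?_ ?_)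
      · rw [abs_mul, abs_abs]
        exact mul_le_mul_of_nonneg_right hab (abs_nonneg _)
      · rw [abs_mul]
        exact mul_le_mul (hg _) (abs_abs_sub_abs_le _ _) (abs_nonneg _) hS
    rw [Finset.sum_add_distrib, ← Finset.mul_sum, ← Finset.mul_sum] at h1
    have h2 : ∑ k ∈ Finset.range d.natAbs, |v (t + k)| ≤ 1 + D := by
      have := h.transfer_one_le (t : UnitAddCircle)
      simpa only [hG.transfer_coe, one_mul] using this
    have h3 : ∑ k ∈ Finset.range d.natAbs, |v (t + k) - v (s + k)| ≤
        D * ((1 + D) * (t - s)) := by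
      refine (hG.sum_abs_sub_le hst).trans (mul_le_mul_of_nonneg_left ?_ hD)
      have := intervalIntegral.integral_mono_on (μ := volume) hst
        (((h.continuous_transfer continuous_const).comp
          (AddCircle.continuous_mk' 1)).intervalIntegrable s t)
        intervalIntegrable_const
        (fun u _ => h.transfer_one_le (u : UnitAddCircle))
      rwa [intervalIntegral.integral_const, smul_eq_mul, mul_comm] at this
    have h4 : 0 ≤ K * (l * (t - s)) := by
      have : 0 ≤ t - s := by linarith
      positivity
    calc _ ≤ _ := h1
      _ ≤ K * (l * (t - s)) * (1 + D) + S * (D * ((1 + D) * (t - s))) := by gcongr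
      _ = _ := by ring
  obtain ⟨s, t, rfl, rfl, hst⟩ := exists_lift_dist x y
  rw [← hst]
  rcases le_total s t with h' | h'
  · rw [abs_sub_comm, abs_sub_comm s t, abs_of_nonneg (sub_nonneg.2 h')]
    exact key s t h'
  · rw [abs_of_nonneg (sub_nonneg.2 h')]
    exact key t s h'

/-- An arc of length `r ≥ l` is stretched by the lift to length at least one, so it contains a
preimage of every point; that preimage alone contributes `a / M`. -/
theorem HasBounds.div_le_transfer {T : UnitAddCircle → UnitAddCircle} {l D M : ℝ}
    (h : HasBounds T l D M) {g : UnitAddCircle → ℝ} (hg : ∀ x, 0 ≤ g x) {a r t₀ : ℝ} 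
    (hlr : l ≤ r) (hga : ∀ t ∈ Set.Icc t₀ (t₀ + r), a ≤ g (t : UnitAddCircle)) (x : UnitAddCircle) :
    a / M ≤ transfer T g x := by
  have hl := h.nonneg.1
  have hr : 0 < r := hl.trans_le hlr
  obtain ⟨F, hF, hT, hb⟩ := id h
  have hdF : Differentiable ℝ F := hF.differentiable (by norm_num)
  obtain ⟨s, rfl⟩ := QuotientAddGroup.mk_surjective x
  have hlen : 1 ≤ |F (t₀ + r) - F t₀| := by
    obtain ⟨c, -, hc⟩ := exists_deriv_eq_slope F (a := t₀) (b := t₀ + r) (by linarith)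
      hdF.continuous.continuousOn hdF.differentiableOn
    have h1 := (hb c).2.1
    have h2 : 0 < |deriv F c| := abs_pos.2 (hb c).1
    rw [add_sub_cancel_left] at hc
    have h3 : F (t₀ + r) - F t₀ = deriv F c * r := by rw [hc]; field_simp
    rw [h3, abs_mul, abs_of_pos hr, ← mul_inv_cancel₀ h2.ne']
    exact mul_le_mul_of_nonneg_left (h1.trans hlr) h2.le
  obtain ⟨m, hm⟩ : ∃ m : ℤ, s + m ∈ Set.uIcc (F t₀) (F (t₀ + r)) := by
    refine ⟨⌈min (F t₀) (F (t₀ + r)) - s⌉, ?_, ?_⟩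
    · have := Int.le_ceil (min (F t₀) (F (t₀ + r)) - s)
      change min _ _ ≤ _
      linarith
    · have := Int.ceil_lt_add_one (min (F t₀) (F (t₀ + r)) - s)
      change _ ≤ max _ _
      have h5 := max_sub_min_eq_abs (F t₀) (F (t₀ + r))
      linarith
  obtain ⟨t, ht, hFt⟩ := intermediate_value_uIcc hdF.continuous.continuousOn hm
  rw [Set.uIcc_of_le (by linarith)] at ht
  have hTt : T (t : UnitAddCircle) = (s : UnitAddCircle) := by
    rw [← hT, hFt]
    exact coe_eq_coe_iff.2 ⟨m, rfl⟩
  rw [h.transfer_eq_sum]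
  refine le_trans ?_ (Finset.single_le_sum (f := fun y => g y / |mapDeriv T y|)
    (fun y _ => div_nonneg (hg y) (abs_nonneg _))
    (show (t : UnitAddCircle) ∈ _ by rw [Set.Finite.mem_toFinset]; exact hTt))
  rw [mapDeriv_coe hdF.continuous hT]
  exact div_le_div₀ (hg _) (hga t ht) (abs_pos.2 (hb t).1) (hb t).2.2.2

/-! ### Composition of two maps -/

theorem HasBounds.comp {T₁ T₂ : UnitAddCircle → UnitAddCircle} {l₁ D₁ M₁ l₂ D₂ M₂ : ℝ}
    (h₂ : HasBounds T₂ l₂ D₂ M₂) (h₁ : HasBounds T₁ l₁ D₁ M₁) :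
    HasBounds (T₂ ∘ T₁) (l₂ * l₁) (D₂ + l₂ * D₁) (M₂ * M₁) := by
  have hp₁ := h₁.nonneg
  have hp₂ := h₂.nonneg
  obtain ⟨F₁, hF₁, hT₁, hb₁⟩ := h₁
  obtain ⟨F₂, hF₂, hT₂, hb₂⟩ := h₂
  have hd₁ : Differentiable ℝ F₁ := hF₁.differentiable (by norm_num)
  have hd₂ : Differentiable ℝ F₂ := hF₂.differentiable (by norm_num)
  have hdd₁ : Differentiable ℝ (deriv F₁) := by
    have : ContDiff ℝ (1 + 1) F₁ := by simpa [one_add_one_eq_two] using hF₁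
    exact (contDiff_succ_iff_deriv.1 this).2.2.differentiable (by norm_num)
  have hdd₂ : Differentiable ℝ (deriv F₂) := by
    have : ContDiff ℝ (1 + 1) F₂ := by simpa [one_add_one_eq_two] using hF₂
    exact (contDiff_succ_iff_deriv.1 this).2.2.differentiable (by norm_num)
  have e1 : deriv (F₂ ∘ F₁) = fun t => deriv F₂ (F₁ t) * deriv F₁ t :=
    funext fun t => deriv_comp t (hd₂ _) (hd₁ _)
  have e2 : ∀ t, deriv (deriv (F₂ ∘ F₁)) t =
      deriv (deriv F₂) (F₁ t) * deriv F₁ t * deriv F₁ t + deriv F₂ (F₁ t) * deriv (deriv F₁) t :=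
    fun t => by
      rw [e1]
      exact ((((hdd₂ _).hasDerivAt.comp t (hd₁ t).hasDerivAt)).mul (hdd₁ t).hasDerivAt).deriv
  refine ⟨F₂ ∘ F₁, hF₂.comp hF₁, fun t => ?_, fun t => ?_⟩
  · simp only [Function.comp_apply, hT₂, hT₁]
  · obtain ⟨a1, a2, a3, a4⟩ := hb₁ t
    obtain ⟨b1, b2, b3, b4⟩ := hb₂ (F₁ t)
    rw [e2, e1]
    simp only
    refine ⟨mul_ne_zero b1 a1, ?_, ?_, ?_⟩
    · rw [abs_mul, mul_inv]
      exact mul_le_mul b2 a2 (by positivity) hp₂.1.le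
    · refine (abs_add_le _ _).trans ?_
      set p := deriv F₂ (F₁ t)
      set q := deriv F₁ t
      have c1 : |deriv (deriv F₂) (F₁ t) * q * q| ≤ D₂ * p ^ 2 * q ^ 2 := by
        rw [mul_assoc, abs_mul, ← pow_two, abs_of_nonneg (sq_nonneg q)]
        exact mul_le_mul_of_nonneg_right b3 (sq_nonneg q)
      -- One factor `1 / |p| ≤ l₂` is spent so that the term with `F₁''`, linear in `p`, is measured
      -- against `(p q)²`.
      have c2 : |p| ≤ l₂ * p ^ 2 := by
        have hp : 0 < |p| := abs_pos.2 b1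
        rw [← sq_abs p]
        calc |p| = |p|⁻¹ * |p| ^ 2 := by field_simp
          _ ≤ _ := by gcongr
      have c3 : |p * deriv (deriv F₁) t| ≤ l₂ * p ^ 2 * (D₁ * q ^ 2) := by
        rw [abs_mul]
        exact mul_le_mul c2 a3 (abs_nonneg _) (mul_nonneg hp₂.1.le (sq_nonneg p))
      calc _ ≤ D₂ * p ^ 2 * q ^ 2 + l₂ * p ^ 2 * (D₁ * q ^ 2) := add_le_add c1 c3
        _ = _ := by ring
    · rw [abs_mul]
      exact mul_le_mul b4 a4 (abs_nonneg _) hp₂.2.2.le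

theorem HasBounds.mapDeriv_comp {T₁ T₂ : UnitAddCircle → UnitAddCircle} {l₁ D₁ M₁ l₂ D₂ M₂ : ℝ}
    (h₂ : HasBounds T₂ l₂ D₂ M₂) (h₁ : HasBounds T₁ l₁ D₁ M₁) (x : UnitAddCircle) :
    mapDeriv (T₂ ∘ T₁) x = mapDeriv T₂ (T₁ x) * mapDeriv T₁ x := by
  obtain ⟨F₁, hF₁, hT₁, -⟩ := h₁
  obtain ⟨F₂, hF₂, hT₂, -⟩ := h₂
  obtain ⟨s, rfl⟩ := QuotientAddGroup.mk_surjective x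
  have e1 := mapDeriv_coe hF₁.continuous hT₁ s
  have e2 := mapDeriv_coe hF₂.continuous hT₂ (F₁ s)
  have e3 := mapDeriv_coe (T := T₂ ∘ T₁) (hF₂.comp hF₁).continuous
    (fun t => by simp only [Function.comp_apply, hT₂, hT₁]) s
  rw [hT₁] at e2
  have e4 := deriv_comp s (hF₂.differentiable (by norm_num) (F₁ s))
    (hF₁.differentiable (by norm_num) s)
  exact e3.trans (e4.trans (by rw [← e1, ← e2]))

theorem HasBounds.transfer_comp {T₁ T₂ : UnitAddCircle → UnitAddCircle} {l₁ D₁ M₁ l₂ D₂ M₂ : ℝ}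
    (h₂ : HasBounds T₂ l₂ D₂ M₂) (h₁ : HasBounds T₁ l₁ D₁ M₁) (g : UnitAddCircle → ℝ)
    (x : UnitAddCircle) :
    transfer (T₂ ∘ T₁) g x = transfer T₂ (transfer T₁ g) x := by
  classical
  rw [(h₂.comp h₁).transfer_eq_sum, h₂.transfer_eq_sum]
  have hset : ((h₂.comp h₁).finite_preimage x).toFinset =
      (h₂.finite_preimage x).toFinset.biUnion fun z => (h₁.finite_preimage z).toFinset := by
    ext y
    simp
  rw [hset, Finset.sum_biUnion]
  · refine Finset.sum_congr rfl fun z _ => ?_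
    rw [h₁.transfer_eq_sum, Finset.sum_div]
    refine Finset.sum_congr rfl fun y hy => ?_
    have hy' : T₁ y = z := by simpa using hy
    rw [h₂.mapDeriv_comp h₁, hy', abs_mul, div_div, mul_comm]
  · intro z _ z' _ hzz
    rw [Function.onFun, Finset.disjoint_left]
    intro y hy hy'
    simp at hy hy'
    exact hzz (hy.symm.trans hy')

/-! ### The averaged transfer operator on continuous functions -/

theorem tendsto_setAverage_ball {f : UnitAddCircle → ℝ} (hf : Continuous f) (x : UnitAddCircle) :
    Filter.Tendsto (fun n : ℕ => ⨍ y in Metric.ball x (1 / ((n : ℝ) + 1)), f y) Filter.atTop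
      (nhds (f x)) := by
  refine Metric.tendsto_atTop.2 fun ε hε => ?_
  obtain ⟨δ, hδ, hball⟩ := Metric.continuous_iff.1 hf x (ε / 2) (half_pos hε)
  obtain ⟨N, hN⟩ := exists_nat_one_div_lt hδ
  refine ⟨N, fun n hn => ?_⟩
  have hpos : (0 : ℝ) < 1 / ((n : ℝ) + 1) := by positivity
  have hle : 1 / ((n : ℝ) + 1) ≤ 1 / ((N : ℝ) + 1) :=
    one_div_le_one_div_of_le (by positivity) (by exact_mod_cast Nat.succ_le_succ hn)
  have hint : Integrable f := hf.integrable_of_hasCompactSupport (HasCompactSupport.of_compactSpace f)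
  have := (convex_closedBall (f x) (ε / 2)).set_average_mem Metric.isClosed_closedBall
    (t := Metric.ball x (1 / ((n : ℝ) + 1))) (f := f)
    (Metric.measure_ball_pos (volume : Measure UnitAddCircle) x hpos).ne' (measure_ne_top _ _)
    ((ae_restrict_iff' measurableSet_ball).2 (Filter.Eventually.of_forall fun y hy =>
      (hball y (lt_of_lt_of_le hy hle |>.trans hN)).le)) hint.integrableOn
  exact lt_of_le_of_lt this (half_lt_self hε)

theorem exists_abs_le {g : UnitAddCircle → ℝ} (hg : Continuous g) : ∃ S, ∀ x, |g x| ≤ S :=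
  ⟨‖(⟨g, hg⟩ : C(UnitAddCircle, ℝ))‖, fun x => ContinuousMap.norm_coe_le_norm ⟨g, hg⟩ x⟩

theorem integrable_of_continuous {g : UnitAddCircle → ℝ} (hg : Continuous g) : Integrable g :=
  hg.integrable_of_hasCompactSupport (HasCompactSupport.of_compactSpace g)

theorem HasBounds.transfer_add {T : UnitAddCircle → UnitAddCircle} {l D M : ℝ}
    (h : HasBounds T l D M) (f g : UnitAddCircle → ℝ) (x : UnitAddCircle) :
    transfer T (fun y => f y + g y) x = transfer T f x + transfer T g x := by
  simp_rw [h.transfer_eq_sum, ← Finset.sum_add_distrib, add_div]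

theorem HasBounds.transfer_const_mul {T : UnitAddCircle → UnitAddCircle} {l D M : ℝ}
    (h : HasBounds T l D M) (c : ℝ) (g : UnitAddCircle → ℝ) (x : UnitAddCircle) :
    transfer T (fun y => c * g y) x = c * transfer T g x := by
  simp_rw [h.transfer_eq_sum, Finset.mul_sum, mul_div_assoc]

variable {Ω : Type*} [MeasurableSpace Ω]

/-- A random circle map together with square integrable bounds `l ≥ |T'|⁻¹`, `D ≥ |T''/T'²|` and a
measurable bound `M ≥ |T'|`. -/
structure SystemBounds (η : Measure Ω) (T : Ω → UnitAddCircle → UnitAddCircle) (l D M : Ω → ℝ) :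
    Prop where
  measurable_map : Measurable fun p : Ω × UnitAddCircle => T p.1 p.2
  bounds : ∀ ω, HasBounds (T ω) (l ω) (D ω) (M ω)
  measurable_l : Measurable l
  measurable_D : Measurable D
  measurable_M : Measurable M
  integrable_l : Integrable (fun ω => l ω ^ 2) η
  integrable_D : Integrable (fun ω => D ω ^ 2) η

namespace SystemBounds

variable {η : Measure Ω} {T : Ω → UnitAddCircle → UnitAddCircle} {l D M : Ω → ℝ}

/-- The value at `x` is a limit of averages over balls, and by the change of variables each average
is an integral of a jointly measurable function of `(ω, y)`. No measurable choice of preimages is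
needed. -/
theorem measurable_transfer (h : SystemBounds η T l D M) {g : UnitAddCircle → ℝ}
    (hg : Continuous g) (x : UnitAddCircle) : Measurable fun ω => transfer (T ω) g x := by
  have key : ∀ g : UnitAddCircle → ℝ, Continuous g → (∀ y, 0 ≤ g y) →
      Measurable fun ω => transfer (T ω) g x := by
    intro g hg hg0
    refine measurable_of_tendsto_metrizable (f := fun (n : ℕ) ω =>
      ⨍ y in Metric.ball x (1 / ((n : ℝ) + 1)), transfer (T ω) g y) (fun n => ?_)
      (tendsto_pi_nhds.2 fun ω =>
        tendsto_setAverage_ball ((h.bounds ω).continuous_transfer hg) x)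
    simp_rw [setAverage_eq, smul_eq_mul]
    refine measurable_const.mul ?_
    set B := Metric.ball x (1 / ((n : ℝ) + 1))
    have hB : Measurable (B.indicator (fun _ => (1 : ℝ≥0∞))) :=
      measurable_const.indicator measurableSet_ball
    have e : ∀ ω, ∫ y in B, transfer (T ω) g y =
        (∫⁻ y, B.indicator (fun _ => 1) (T ω y) * ENNReal.ofReal (g y)).toReal := fun ω => by
      rw [← (h.bounds ω).lintegral_transfer hB hg.measurable hg0, integral_eq_lintegral_of_nonneg_ae
        (Filter.Eventually.of_forall ((h.bounds ω).transfer_nonneg hg0))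
        ((h.bounds ω).continuous_transfer hg).aestronglyMeasurable,
        ← lintegral_indicator measurableSet_ball]
      congr 2
      ext y
      by_cases hy : y ∈ B
      · rw [Set.indicator_of_mem hy, Set.indicator_of_mem hy, one_mul]
      · rw [Set.indicator_of_notMem hy, Set.indicator_of_notMem hy, zero_mul]
    simp_rw [e]
    refine Measurable.ennreal_toReal (Measurable.lintegral_prod_right' (f := fun p : Ω × UnitAddCircle =>
      B.indicator (fun _ => (1 : ℝ≥0∞)) (T p.1 p.2) * ENNReal.ofReal (g p.2)) ?_)
    exact (hB.comp h.measurable_map).mul (hg.measurable.comp measurable_snd).ennreal_ofReal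
  obtain ⟨S, hS⟩ := exists_abs_le hg
  have hS0 : 0 ≤ S := (abs_nonneg _).trans (hS 0)
  -- The change of variables is for nonnegative functions, hence the shift by a constant.
  have e : (fun ω => transfer (T ω) g x) = fun ω =>
      transfer (T ω) (fun y => g y + S) x - transfer (T ω) (fun _ => S) x := by
    ext ω
    rw [(h.bounds ω).transfer_add g (fun _ => S)]
    ring
  rw [e]
  exact (key _ (by fun_prop) fun y => by linarith [(abs_le.1 (hS y)).1]).sub
    (key _ continuous_const fun _ => hS0)

theorem integrable_D_one [IsProbabilityMeasure η] (h : SystemBounds η T l D M) : Integrable D η :=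
  ((memLp_two_iff_integrable_sq h.measurable_D.aestronglyMeasurable).2 h.integrable_D).integrable
    one_le_two

theorem integrable_l_one [IsProbabilityMeasure η] (h : SystemBounds η T l D M) : Integrable l η :=
  ((memLp_two_iff_integrable_sq h.measurable_l.aestronglyMeasurable).2 h.integrable_l).integrable
    one_le_two

theorem integrable_l_mul_D (h : SystemBounds η T l D M) : Integrable (fun ω => l ω * D ω) η :=
  ((memLp_two_iff_integrable_sq h.measurable_l.aestronglyMeasurable).2 h.integrable_l).integrable_mul
    ((memLp_two_iff_integrable_sq h.measurable_D.aestronglyMeasurable).2 h.integrable_D)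

theorem integrable_transfer [IsProbabilityMeasure η] (h : SystemBounds η T l D M)
    {g : UnitAddCircle → ℝ} (hg : Continuous g) (x : UnitAddCircle) :
    Integrable (fun ω => transfer (T ω) g x) η := by
  obtain ⟨S, hS⟩ := exists_abs_le hg
  exact (((integrable_const (1 : ℝ)).add h.integrable_D_one).const_mul S).mono'
    (h.measurable_transfer hg x).aestronglyMeasurable
    (Filter.Eventually.of_forall fun ω => (h.bounds ω).abs_transfer_le hS x)

theorem continuous_avgTransfer [IsProbabilityMeasure η] (h : SystemBounds η T l D M)
    {g : UnitAddCircle → ℝ} (hg : Continuous g) : Continuous (avgTransfer η T g) := by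
  obtain ⟨S, hS⟩ := exists_abs_le hg
  exact continuous_of_dominated (bound := fun ω => S * (1 + D ω))
    (fun x => (h.measurable_transfer hg x).aestronglyMeasurable)
    (fun x => Filter.Eventually.of_forall fun ω => (h.bounds ω).abs_transfer_le hS x)
    (((integrable_const (1 : ℝ)).add h.integrable_D_one).const_mul S)
    (Filter.Eventually.of_forall fun ω => (h.bounds ω).continuous_transfer hg)

/-- The averaged transfer operator acting on continuous functions. -/
def op [IsProbabilityMeasure η] (h : SystemBounds η T l D M) :
    C(UnitAddCircle, ℝ) →ₗ[ℝ] C(UnitAddCircle, ℝ) where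
  toFun g := ⟨avgTransfer η T g, h.continuous_avgTransfer g.continuous⟩
  map_add' f g := by
    ext x
    change ∫ ω, transfer (T ω) (fun y => f y + g y) x ∂η = _ + _
    simp_rw [fun ω => (h.bounds ω).transfer_add f g x]
    exact integral_add (h.integrable_transfer f.continuous x)
      (h.integrable_transfer g.continuous x)
  map_smul' c g := by
    ext x
    change ∫ ω, transfer (T ω) (fun y => c * g y) x ∂η = c * _
    simp_rw [fun ω => (h.bounds ω).transfer_const_mul c g x]
    exact integral_const_mul _ _

theorem op_apply [IsProbabilityMeasure η] (h : SystemBounds η T l D M) (g : C(UnitAddCircle, ℝ))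
    (x : UnitAddCircle) : h.op g x = ∫ ω, transfer (T ω) g x ∂η := rfl

theorem coe_op [IsProbabilityMeasure η] (h : SystemBounds η T l D M) (g : C(UnitAddCircle, ℝ)) :
    ⇑(h.op g) = avgTransfer η T g := rfl

theorem coe_op_pow [IsProbabilityMeasure η] (h : SystemBounds η T l D M) (g : C(UnitAddCircle, ℝ))
    (n : ℕ) : ⇑((h.op ^ n) g) = (avgTransfer η T)^[n] g := by
  induction n with
  | zero => rfl
  | succ n ih => rw [pow_succ', Module.End.mul_apply, coe_op, ih, Function.iterate_succ_apply']

theorem op_nonneg [IsProbabilityMeasure η] (h : SystemBounds η T l D M) {g : C(UnitAddCircle, ℝ)}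
    (hg : ∀ x, 0 ≤ g x) (x : UnitAddCircle) : 0 ≤ h.op g x :=
  integral_nonneg fun ω => (h.bounds ω).transfer_nonneg hg x

theorem abs_op_sub_le [IsProbabilityMeasure η] (h : SystemBounds η T l D M)
    {g : C(UnitAddCircle, ℝ)} {K S : ℝ} (hg : ∀ y, |g y| ≤ S) (hK : 0 ≤ K)
    (hL : ∀ x y, |g x - g y| ≤ K * dist x y) (x y : UnitAddCircle) :
    |h.op g x - h.op g y| ≤
      (K * (∫ ω, l ω ∂η + ∫ ω, l ω * D ω ∂η) + S * (∫ ω, D ω ∂η + ∫ ω, D ω ^ 2 ∂η)) * dist x y := by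
  rw [op_apply, op_apply, ← integral_sub (h.integrable_transfer g.continuous x)
    (h.integrable_transfer g.continuous y)]
  have i1 : Integrable (fun ω => l ω + l ω * D ω) η :=
    h.integrable_l_one.add h.integrable_l_mul_D
  have i2 : Integrable (fun ω => D ω + D ω ^ 2) η := h.integrable_D_one.add h.integrable_D
  rw [← integral_add h.integrable_l_one h.integrable_l_mul_D,
    ← integral_add h.integrable_D_one h.integrable_D, ← integral_const_mul, ← integral_const_mul,
    ← integral_add (i1.const_mul K) (i2.const_mul S), ← integral_mul_const]
  rw [← Real.norm_eq_abs]
  refine norm_integral_le_of_norm_le (((i1.const_mul K).add (i2.const_mul S)).mul_const _)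
    (Filter.Eventually.of_forall fun ω => ?_)
  refine ((h.bounds ω).abs_transfer_sub_le hg hK hL x y).trans_eq ?_
  ring

/-- `E l² < r²` forces `l ≤ r` with positive probability, and each such map spreads the mass of an
arc of length `r` over the circle. The constant `c` is uniform in `g` and in the arc. -/
theorem le_op [IsProbabilityMeasure η] (h : SystemBounds η T l D M) {r : ℝ}
    (hr : ∫ ω, l ω ^ 2 ∂η < r ^ 2) (hr0 : 0 < r) :
    ∃ c > 0, ∀ g : C(UnitAddCircle, ℝ), (∀ x, 0 ≤ g x) → ∀ (a t₀ : ℝ), 0 ≤ a →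
      (∀ t ∈ Set.Icc t₀ (t₀ + r), a ≤ g (t : UnitAddCircle)) → ∀ x, a * c ≤ h.op g x := by
  set A : Set Ω := {ω | l ω ≤ r} with hA
  have hAm : MeasurableSet A := measurableSet_le h.measurable_l measurable_const
  have hApos : 0 < η A := by
    by_contra! hA0
    have hae : ∀ᵐ ω ∂η, r ^ 2 ≤ l ω ^ 2 := by
      have : ∀ᵐ ω ∂η, ω ∉ A := measure_eq_zero_iff_ae_notMem.1 (le_antisymm hA0 bot_le)
      filter_upwards [this] with ω hω
      have : r < l ω := not_le.1 hω
      gcongr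
    have := integral_mono_ae (integrable_const (r ^ 2)) h.integrable_l hae
    simp at this
    linarith
  -- `min` keeps the weight integrable
  set w : Ω → ℝ := A.indicator fun ω => min 1 (1 / M ω) with hw
  have hwm : Measurable w := by
    have := h.measurable_M
    exact (by fun_prop : Measurable fun ω => min 1 (1 / M ω)).indicator hAm
  have hMp : ∀ ω, 0 < min 1 (1 / M ω) := fun ω =>
    lt_min one_pos (one_div_pos.2 (h.bounds ω).nonneg.2.2)
  have hw0 : ∀ ω, 0 ≤ w ω := fun ω => Set.indicator_nonneg (fun ω _ => (hMp ω).le) ω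
  have hwi : Integrable w η := by
    refine (integrable_const (1 : ℝ)).mono' hwm.aestronglyMeasurable
      (Filter.Eventually.of_forall fun ω => ?_)
    rw [Real.norm_of_nonneg (hw0 ω)]
    by_cases hω : ω ∈ A <;> simp [hw, hω]
  refine ⟨∫ ω, w ω ∂η, ?_, fun g hg a t₀ ha hga x => ?_⟩
  · rw [gt_iff_lt, integral_pos_iff_support_of_nonneg hw0 hwi]
    refine hApos.trans_le (measure_mono fun ω hω => ?_)
    rw [Function.mem_support, hw, Set.indicator_of_mem hω]
    exact (hMp ω).ne'
  · rw [← integral_const_mul, op_apply]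
    refine integral_mono (hwi.const_mul a) (h.integrable_transfer g.continuous x) fun ω => ?_
    by_cases hω : ω ∈ A
    · have h1 := (h.bounds ω).div_le_transfer hg hω hga x
      simp only [hw, Set.indicator_of_mem hω]
      refine le_trans ?_ h1
      rw [div_eq_mul_one_div a]
      exact mul_le_mul_of_nonneg_left (min_le_right _ _) ha
    · simp only [hw, Set.indicator_of_notMem hω, mul_zero]
      exact (h.bounds ω).transfer_nonneg hg x

theorem measurable_uncurry_transfer (h : SystemBounds η T l D M) {g : UnitAddCircle → ℝ}
    (hg : Continuous g) : Measurable fun p : UnitAddCircle × Ω => transfer (T p.2) g p.1 :=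
  (stronglyMeasurable_uncurry_of_continuous_of_stronglyMeasurable
    (u := fun x ω => transfer (T ω) g x) (fun ω => (h.bounds ω).continuous_transfer hg)
    (fun x => (h.measurable_transfer hg x).stronglyMeasurable)).measurable

theorem lintegral_op [IsProbabilityMeasure η] (h : SystemBounds η T l D M)
    {f : UnitAddCircle → ℝ≥0∞} (hf : Measurable f) {g : C(UnitAddCircle, ℝ)}
    (hg : ∀ x, 0 ≤ g x) :
    ∫⁻ x, f x * ENNReal.ofReal (h.op g x) =
      ∫⁻ ω, (∫⁻ x, f (T ω x) * ENNReal.ofReal (g x)) ∂η := by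
  have hm := h.measurable_uncurry_transfer g.continuous
  have e : ∀ x, f x * ENNReal.ofReal (h.op g x) =
      ∫⁻ ω, f x * ENNReal.ofReal (transfer (T ω) g x) ∂η := fun x => by
    rw [op_apply, ofReal_integral_eq_lintegral_ofReal (h.integrable_transfer g.continuous x)
      (Filter.Eventually.of_forall fun ω => (h.bounds ω).transfer_nonneg hg x),
      lintegral_const_mul (f x) (h.measurable_transfer g.continuous x).ennreal_ofReal]
  simp_rw [e]
  rw [lintegral_lintegral_swap (((hf.comp measurable_fst).mul hm.ennreal_ofReal).aemeasurable)]
  simp_rw [fun ω => (h.bounds ω).lintegral_transfer hf g.continuous.measurable hg]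

/-- Probabilistic form of duality: if `x` has density `g` and is independent of `ω`, then `T_ω x`
has density `h.op g`. Vector-valued duality then follows by integrating against a pushforward. -/
theorem map_prod_withDensity [IsProbabilityMeasure η] (h : SystemBounds η T l D M)
    {g : C(UnitAddCircle, ℝ)} (hg : ∀ x, 0 ≤ g x) :
    (η.prod (volume.withDensity fun x => ENNReal.ofReal (g x))).map (fun p => T p.1 p.2) =
      volume.withDensity fun x => ENNReal.ofReal (h.op g x) := by
  have hgm : Measurable fun x => ENNReal.ofReal (g x) := g.continuous.measurable.ennreal_ofReal
  have hom : Measurable fun x => ENNReal.ofReal (h.op g x) :=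
    (h.op g).continuous.measurable.ennreal_ofReal
  refine Measure.ext_of_lintegral _ fun f hf => ?_
  have hfT : Measurable fun p : Ω × UnitAddCircle => f (T p.1 p.2) := hf.comp h.measurable_map
  rw [lintegral_map hf h.measurable_map, lintegral_prod _ hfT.aemeasurable,
    lintegral_withDensity_eq_lintegral_mul _ hom hf]
  simp only [Pi.mul_apply]
  simp_rw [fun x => mul_comm (ENNReal.ofReal (h.op g x)) (f x)]
  rw [h.lintegral_op hf hg]
  refine lintegral_congr fun ω => ?_
  rw [lintegral_withDensity_eq_lintegral_mul _ hgm
    (show Measurable fun x => f (T ω x) from hfT.comp measurable_prodMk_left)]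
  simp only [Pi.mul_apply, mul_comm]

end SystemBounds

/-! ### Duality between the transfer and the Markov operator -/

theorem integrable_smul_of_bounded {E : Type*} [NormedAddCommGroup E] [NormedSpace ℝ E]
    {f : UnitAddCircle → E} {B : ℝ} (g : C(UnitAddCircle, ℝ)) (hf : StronglyMeasurable f)
    (hB : ∀ x, ‖f x‖ ≤ B) : Integrable fun x => g x • f x :=
  (integrable_of_continuous g.continuous).smul_bdd B hf.aestronglyMeasurable
    (Filter.Eventually.of_forall hB)

theorem norm_markovOp_le {Ω : Type*} [MeasurableSpace Ω] {η : Measure Ω} [IsProbabilityMeasure η]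
    {E : Type*} [NormedAddCommGroup E] [NormedSpace ℝ E] (T : Ω → UnitAddCircle → UnitAddCircle)
    {f : UnitAddCircle → E} {B : ℝ} (hB : ∀ x, ‖f x‖ ≤ B) (x : UnitAddCircle) :
    ‖markovOp η T f x‖ ≤ B := by
  have := norm_integral_le_of_norm_le_const (μ := η) (f := fun ω => f (T ω x))
    (Filter.Eventually.of_forall fun ω => hB _)
  simpa [markovOp] using this

theorem norm_markovOp_iterate_le {Ω : Type*} [MeasurableSpace Ω] {η : Measure Ω}
    [IsProbabilityMeasure η] {E : Type*} [NormedAddCommGroup E] [NormedSpace ℝ E]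
    (T : Ω → UnitAddCircle → UnitAddCircle) {f : UnitAddCircle → E} {B : ℝ}
    (hB : ∀ x, ‖f x‖ ≤ B) (n : ℕ) (x : UnitAddCircle) : ‖(markovOp η T)^[n] f x‖ ≤ B := by
  induction n generalizing x with
  | zero => exact hB x
  | succ n ih =>
    rw [Function.iterate_succ_apply']
    exact norm_markovOp_le T ih x

theorem integral_withDensity_ofReal {E : Type*} [NormedAddCommGroup E] [NormedSpace ℝ E]
    {g : UnitAddCircle → ℝ} (hg : Continuous g) (hg0 : ∀ x, 0 ≤ g x) (f : UnitAddCircle → E) :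
    ∫ x, f x ∂(volume.withDensity fun x => ENNReal.ofReal (g x)) = ∫ x, g x • f x := by
  rw [integral_withDensity_eq_integral_toReal_smul hg.measurable.ennreal_ofReal
    (Filter.Eventually.of_forall fun x => ENNReal.ofReal_lt_top)]
  simp_rw [fun x => ENNReal.toReal_ofReal (hg0 x)]

theorem isFiniteMeasure_withDensity {g : UnitAddCircle → ℝ} (hg : Continuous g) :
    IsFiniteMeasure ((volume : Measure UnitAddCircle).withDensity fun x => ENNReal.ofReal (g x)) :=
  isFiniteMeasure_withDensity_ofReal (integrable_of_continuous hg).2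

namespace SystemBounds

section Duality

variable {Ω : Type*} [MeasurableSpace Ω] {η : Measure Ω} [IsProbabilityMeasure η]
  {T : Ω → UnitAddCircle → UnitAddCircle} {l D M : Ω → ℝ}
  {E : Type*} [NormedAddCommGroup E] [NormedSpace ℝ E] {f : UnitAddCircle → E} {B : ℝ}

theorem stronglyMeasurable_markovOp (h : SystemBounds η T l D M) (hf : StronglyMeasurable f) :
    StronglyMeasurable (markovOp η T f) :=
  (hf.comp_measurable h.measurable_map).integral_prod_left'

theorem stronglyMeasurable_markovOp_iterate (h : SystemBounds η T l D M)
    (hf : StronglyMeasurable f) (n : ℕ) : StronglyMeasurable ((markovOp η T)^[n] f) := by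
  induction n with
  | zero => exact hf
  | succ n ih =>
    rw [Function.iterate_succ_apply']
    exact h.stronglyMeasurable_markovOp ih

theorem integral_op_smul_of_nonneg (h : SystemBounds η T l D M) (hf : StronglyMeasurable f)
    (hB : ∀ x, ‖f x‖ ≤ B) {g : C(UnitAddCircle, ℝ)} (hg : ∀ x, 0 ≤ g x) :
    ∫ x, h.op g x • f x = ∫ x, g x • markovOp η T f x := by
  have := isFiniteMeasure_withDensity g.continuous
  rw [← integral_withDensity_ofReal (h.op g).continuous (h.op_nonneg hg),
    ← integral_withDensity_ofReal g.continuous hg, ← h.map_prod_withDensity hg,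
    integral_map h.measurable_map.aemeasurable hf.aestronglyMeasurable, integral_prod_symm]
  · rfl
  · exact (integrable_const B).mono' (hf.comp_measurable h.measurable_map).aestronglyMeasurable
      (Filter.Eventually.of_forall fun p => hB _)

theorem integral_op_smul (h : SystemBounds η T l D M) (hf : StronglyMeasurable f)
    (hB : ∀ x, ‖f x‖ ≤ B) (g : C(UnitAddCircle, ℝ)) :
    ∫ x, h.op g x • f x = ∫ x, g x • markovOp η T f x := by
  have hQ := h.stronglyMeasurable_markovOp hf
  have hQB := norm_markovOp_le (η := η) T hB
  -- Adding the constant `‖g‖` reduces to nonnegative functions.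
  set c : C(UnitAddCircle, ℝ) := ContinuousMap.const _ ‖g‖
  have h1 := h.integral_op_smul_of_nonneg hf hB (g := g + c)
    (fun x => by have := g.neg_norm_le_apply x; simp [c]; linarith)
  have h2 := h.integral_op_smul_of_nonneg hf hB (g := c) (fun x => norm_nonneg g)
  rw [map_add] at h1
  simp only [ContinuousMap.add_apply, add_smul] at h1
  rw [integral_add (integrable_smul_of_bounded _ hf hB) (integrable_smul_of_bounded _ hf hB),
    integral_add (integrable_smul_of_bounded _ hQ hQB) (integrable_smul_of_bounded _ hQ hQB),
    h2] at h1
  exact add_right_cancel h1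

theorem integral_op_pow_smul (h : SystemBounds η T l D M) (hf : StronglyMeasurable f)
    (hB : ∀ x, ‖f x‖ ≤ B) (g : C(UnitAddCircle, ℝ)) (n : ℕ) :
    ∫ x, (h.op ^ n) g x • f x = ∫ x, g x • (markovOp η T)^[n] f x := by
  induction n generalizing g with
  | zero => rfl
  | succ n ih =>
    rw [pow_succ, Module.End.mul_apply, ih, h.integral_op_smul
      (h.stronglyMeasurable_markovOp_iterate hf n) (norm_markovOp_iterate_le T hB n),
      Function.iterate_succ_apply']

theorem integral_op (h : SystemBounds η T l D M) (g : C(UnitAddCircle, ℝ)) :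
    ∫ x, h.op g x = ∫ x, g x := by
  simpa [markovOp] using h.integral_op_smul (f := fun _ => (1 : ℝ)) (B := 1)
    stronglyMeasurable_const (by simp) g

end Duality

/-! ### Independent compositions and iterates -/

section Product

variable {Ω₁ Ω₂ : Type*} [MeasurableSpace Ω₁] [MeasurableSpace Ω₂] {η₁ : Measure Ω₁}
  {η₂ : Measure Ω₂} [IsProbabilityMeasure η₁]
  {T₁ : Ω₁ → UnitAddCircle → UnitAddCircle} {T₂ : Ω₂ → UnitAddCircle → UnitAddCircle}
  {l₁ D₁ M₁ : Ω₁ → ℝ} {l₂ D₂ M₂ : Ω₂ → ℝ}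

/-- The free `ε` allows the coefficient of `b ^ 2` to be close to one, which keeps the recursion for
`E D²` contracting. -/
theorem sq_add_mul_le (a b : ℝ) {ε : ℝ} (hε : 0 < ε) :
    (a + b) ^ 2 ≤ (1 + 1 / ε) * a ^ 2 + (1 + ε) * b ^ 2 := by
  have h : (1 + 1 / ε) * a ^ 2 + (1 + ε) * b ^ 2 - (a + b) ^ 2 = (a - ε * b) ^ 2 / ε := by
    field_simp
    ring
  have : 0 ≤ (a - ε * b) ^ 2 / ε := by positivity
  linarith

theorem integrable_bound (h₂ : SystemBounds η₂ T₂ l₂ D₂ M₂) (h₁ : SystemBounds η₁ T₁ l₁ D₁ M₁)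
    (ε : ℝ) : Integrable (fun p : Ω₂ × Ω₁ => (1 + 1 / ε) * D₂ p.1 ^ 2 +
      (1 + ε) * (l₂ p.1 ^ 2 * D₁ p.2 ^ 2)) (η₂.prod η₁) :=
  ((h₂.integrable_D.comp_fst η₁).const_mul _).add
    ((h₂.integrable_l.mul_prod h₁.integrable_D).const_mul _)

theorem prod (h₂ : SystemBounds η₂ T₂ l₂ D₂ M₂) (h₁ : SystemBounds η₁ T₁ l₁ D₁ M₁) :
    SystemBounds (η₂.prod η₁) (fun p : Ω₂ × Ω₁ => T₂ p.1 ∘ T₁ p.2) (fun p => l₂ p.1 * l₁ p.2)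
      (fun p => D₂ p.1 + l₂ p.1 * D₁ p.2) (fun p => M₂ p.1 * M₁ p.2) := by
  have hl₁ := h₁.measurable_l
  have hl₂ := h₂.measurable_l
  have hD₁ := h₁.measurable_D
  have hD₂ := h₂.measurable_D
  have hM₁ := h₁.measurable_M
  have hM₂ := h₂.measurable_M
  refine ⟨?_, fun p => (h₂.bounds p.1).comp (h₁.bounds p.2), by fun_prop, by fun_prop,
    by fun_prop, ?_, ?_⟩
  · exact h₂.measurable_map.comp ((measurable_fst.comp measurable_fst).prodMk
      (h₁.measurable_map.comp ((measurable_snd.comp measurable_fst).prodMk measurable_snd)))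
  · simp_rw [mul_pow]
    exact h₂.integrable_l.mul_prod h₁.integrable_l
  · refine (integrable_bound h₂ h₁ 1).mono' (by fun_prop)
      (Filter.Eventually.of_forall fun p => ?_)
    rw [Real.norm_of_nonneg (sq_nonneg _), ← mul_pow]
    exact sq_add_mul_le _ _ one_pos

variable [IsProbabilityMeasure η₂]

theorem integral_prod_D_le (h₂ : SystemBounds η₂ T₂ l₂ D₂ M₂)
    (h₁ : SystemBounds η₁ T₁ l₁ D₁ M₁) {ε : ℝ} (hε : 0 < ε) :
    ∫ p, (D₂ p.1 + l₂ p.1 * D₁ p.2) ^ 2 ∂(η₂.prod η₁) ≤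
      (1 + 1 / ε) * ∫ ω, D₂ ω ^ 2 ∂η₂ + (1 + ε) * ((∫ ω, l₂ ω ^ 2 ∂η₂) * ∫ ω, D₁ ω ^ 2 ∂η₁) := by
  refine (integral_mono (h₂.prod h₁).integrable_D (integrable_bound h₂ h₁ ε) fun p => ?_).trans_eq ?_
  · simp only [← mul_pow]
    exact sq_add_mul_le _ _ hε
  · rw [integral_add ((h₂.integrable_D.comp_fst η₁).const_mul _)
      ((h₂.integrable_l.mul_prod h₁.integrable_D).const_mul _), integral_const_mul,
      integral_const_mul, integral_prod_mul (fun ω => l₂ ω ^ 2) (fun ω => D₁ ω ^ 2),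
      integral_fun_fst (fun ω => D₂ ω ^ 2)]
    simp

/-- Fubini together with functoriality of transfer; the fibre of the outer map is finite, so its sum
commutes with the integral over the inner parameter. -/
theorem op_prod (h₂ : SystemBounds η₂ T₂ l₂ D₂ M₂) (h₁ : SystemBounds η₁ T₁ l₁ D₁ M₁) :
    (h₂.prod h₁).op = h₂.op * h₁.op := by
  ext g x
  rw [Module.End.mul_apply, op_apply,
    integral_prod _ ((h₂.prod h₁).integrable_transfer g.continuous x), op_apply]
  refine integral_congr_ae (Filter.Eventually.of_forall fun ω₂ => ?_)
  simp_rw [fun ω₁ => (h₂.bounds ω₂).transfer_comp (h₁.bounds ω₁) g x,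
    fun g => (h₂.bounds ω₂).transfer_eq_sum g x]
  rw [integral_finsetSum _ fun y _ => (h₁.integrable_transfer g.continuous y).div_const _]
  refine Finset.sum_congr rfl fun y _ => ?_
  rw [integral_div]
  rfl

end Product

universe u

/-- Every positive power of the operator is again the operator of a random system, so the one-step
estimates apply to it. The bound `K` on `E D²` does not depend on `n`, while `E l²` tends to zero.
-/
theorem exists_iterate {Ω : Type u} [MeasurableSpace Ω] {η : Measure Ω} [IsProbabilityMeasure η]
    {T : Ω → UnitAddCircle → UnitAddCircle} {l D M : Ω → ℝ} (h : SystemBounds η T l D M)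
    (hq : ∫ ω, l ω ^ 2 ∂η < 1) :
    ∃ K, ∀ n : ℕ, ∃ (Ω' : Type u) (_ : MeasurableSpace Ω') (η' : Measure Ω')
      (_ : IsProbabilityMeasure η') (T' : Ω' → UnitAddCircle → UnitAddCircle) (l' D' M' : Ω' → ℝ)
      (h' : SystemBounds η' T' l' D' M'), h'.op = h.op ^ (n + 1) ∧
        ∫ ω, l' ω ^ 2 ∂η' = (∫ ω, l ω ^ 2 ∂η) ^ (n + 1) ∧ ∫ ω, D' ω ^ 2 ∂η' ≤ K := by
  set q := ∫ ω, l ω ^ 2 ∂η with hqdef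
  set δ := ∫ ω, D ω ^ 2 ∂η with hδ
  have hq0 : 0 ≤ q := integral_nonneg fun ω => sq_nonneg _
  have hδ0 : 0 ≤ δ := integral_nonneg fun ω => sq_nonneg _
  obtain ⟨ε, hε, hεq⟩ : ∃ ε > 0, (1 + ε) * q < 1 :=
    ⟨(1 - q) / 2, by linarith, by nlinarith⟩
  have hpos : 0 < 1 - (1 + ε) * q := by linarith
  -- `K` is the fixed point of the recursion `x ↦ (1 + 1 / ε) δ + (1 + ε) q x` obtained by composing
  -- with one more outer map.
  set K := (1 + 1 / ε) * δ / (1 - (1 + ε) * q) with hK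
  have hKeq : (1 + 1 / ε) * δ + (1 + ε) * (q * K) = K := by
    rw [hK]
    field_simp
    ring
  have hδK : δ ≤ K := by
    have hK0 : 0 ≤ K := by positivity
    have h1 : 0 ≤ 1 / ε * δ := by positivity
    have h2 : 0 ≤ (1 + ε) * (q * K) := by positivity
    linarith
  refine ⟨K, fun n => ?_⟩
  induction n with
  | zero => exact ⟨Ω, _, η, inferInstance, T, l, D, M, h, by simp, by simp [hqdef], hδK⟩
  | succ n ih =>
    obtain ⟨Ω', _, η', _, T', l', D', M', h', h1, h2, h3⟩ := ih
    refine ⟨Ω × Ω', _, η.prod η', inferInstance, _, _, _, _, h.prod h', ?_, ?_, ?_⟩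
    · rw [h.op_prod h', h1, ← pow_succ']
    · simp_rw [mul_pow]
      rw [integral_prod_mul (fun ω => l ω ^ 2) (fun ω => l' ω ^ 2), h2, ← hqdef, ← pow_succ']
    · refine (h.integral_prod_D_le h' hε).trans ?_
      rw [← hKeq]
      gcongr

end SystemBounds

/-! ### Lipschitz functions and densities on the circle -/

instance isProbabilityMeasure_volume : IsProbabilityMeasure (volume : Measure UnitAddCircle) :=
  ⟨by simp⟩

theorem dist_le_one (x y : UnitAddCircle) : dist x y ≤ 1 := by
  have := AddCircle.norm_le_half_period (1 : ℝ) (x := x - y) one_ne_zero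
  rw [dist_eq_norm]
  refine this.trans ?_
  norm_num

theorem integrable_coe (g : C(UnitAddCircle, ℝ)) : Integrable g :=
  integrable_of_continuous g.continuous

theorem integrable_abs_coe (g : C(UnitAddCircle, ℝ)) : Integrable fun x => |g x| :=
  (integrable_coe g).abs

theorem integral_abs_le_norm (g : C(UnitAddCircle, ℝ)) : ∫ x, |g x| ≤ ‖g‖ := by
  have := integral_mono (integrable_abs_coe g) (integrable_const ‖g‖) g.norm_coe_le_norm
  simpa using this

theorem integral_abs_add_le (f g : C(UnitAddCircle, ℝ)) :
    ∫ x, |(f + g) x| ≤ (∫ x, |f x|) + ∫ x, |g x| := by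
  rw [← integral_add (integrable_abs_coe f) (integrable_abs_coe g)]
  exact integral_mono (integrable_abs_coe _) ((integrable_abs_coe f).add (integrable_abs_coe g))
    fun x => abs_add_le _ _

theorem eq_zero_of_integral_abs_le_zero {g : C(UnitAddCircle, ℝ)} (h : ∫ x, |g x| ≤ 0) : g = 0 := by
  have h0 := le_antisymm h (integral_nonneg fun x => abs_nonneg (g x))
  rw [integral_eq_zero_iff_of_nonneg (fun x => abs_nonneg (g x)) (integrable_abs_coe g)] at h0
  have h1 : (fun x => |g x|) = 0 :=
    Measure.eq_of_ae_eq h0 g.continuous.abs continuous_const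
  ext x
  exact abs_eq_zero.1 (congrFun h1 x)

/-- `g` is Lipschitz continuous with constant `K`. -/
def IsLip (K : ℝ) (g : C(UnitAddCircle, ℝ)) : Prop := ∀ x y, |g x - g y| ≤ K * dist x y

theorem IsLip.add {K L : ℝ} {f g : C(UnitAddCircle, ℝ)} (hf : IsLip K f) (hg : IsLip L g) :
    IsLip (K + L) (f + g) := fun x y => by
  calc |(f + g) x - (f + g) y| = |(f x - f y) + (g x - g y)| := by
        simp only [ContinuousMap.add_apply]; ring_nf
    _ ≤ _ := abs_add_le _ _
    _ ≤ _ := by rw [add_mul]; exact add_le_add (hf x y) (hg x y)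

theorem IsLip.smul {K : ℝ} {g : C(UnitAddCircle, ℝ)} (hg : IsLip K g) (a : ℝ) :
    IsLip (|a| * K) (a • g) := fun x y => by
  rw [ContinuousMap.smul_apply, ContinuousMap.smul_apply, smul_eq_mul, smul_eq_mul, ← mul_sub,
    abs_mul, mul_assoc]
  exact mul_le_mul_of_nonneg_left (hg x y) (abs_nonneg a)

theorem IsLip.sub {K L : ℝ} {f g : C(UnitAddCircle, ℝ)} (hf : IsLip K f) (hg : IsLip L g) :
    IsLip (K + L) (f - g) := by
  have := hf.add (hg.smul (-1))
  simpa [sub_eq_add_neg] using this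

theorem IsLip.mono {K L : ℝ} {g : C(UnitAddCircle, ℝ)} (hg : IsLip K g) (h : K ≤ L) : IsLip L g :=
  fun x y => (hg x y).trans (mul_le_mul_of_nonneg_right h dist_nonneg)

theorem isLip_one : IsLip 0 1 := fun x y => by simp

theorem IsLip.abs_le_of_integral_eq_zero {K : ℝ} (hK : 0 ≤ K) {g : C(UnitAddCircle, ℝ)}
    (hg : IsLip K g) (h0 : ∫ x, g x = 0) (x : UnitAddCircle) : |g x| ≤ K := by
  have e : g x = ∫ y, (g x - g y) := by
    rw [integral_sub (integrable_const _) (integrable_coe g), h0]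
    simp
  rw [e]
  have := norm_integral_le_of_norm_le_const (μ := (volume : Measure UnitAddCircle))
    (f := fun y => g x - g y) (C := K) (Filter.Eventually.of_forall fun y =>
      (hg x y).trans (mul_le_of_le_one_right hK (dist_le_one x y)))
  simpa using this

/-- Interpolation of the sup norm between the Lipschitz constant and the `L¹` norm: on the ball of
radius `ε`, of measure at least `ε`, `|g|` stays above `|g x| - K ε`. -/
theorem IsLip.abs_le {K : ℝ} (hK : 0 ≤ K) {g : C(UnitAddCircle, ℝ)} (hg : IsLip K g) {ε : ℝ}
    (hε : 0 < ε) (hε1 : ε ≤ 1) (x : UnitAddCircle) : |g x| ≤ K * ε + (∫ y, |g y|) / ε := by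
  have hI : 0 ≤ ∫ y, |g y| := integral_nonneg fun y => abs_nonneg _
  rcases le_total (|g x|) (K * ε) with h | h
  · have : 0 ≤ (∫ y, |g y|) / ε := by positivity
    linarith
  rw [← sub_le_iff_le_add', le_div_iff₀ hε]
  have hvol : ε ≤ (volume : Measure UnitAddCircle).real (Metric.closedBall x ε) := by
    rw [Measure.real, AddCircle.volume_closedBall, ENNReal.toReal_ofReal (by positivity)]
    exact le_min hε1 (by linarith)
  calc (|g x| - K * ε) * ε
      ≤ (|g x| - K * ε) * (volume : Measure UnitAddCircle).real (Metric.closedBall x ε) :=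
        mul_le_mul_of_nonneg_left hvol (by linarith)
    _ = ∫ y in Metric.closedBall x ε, (|g x| - K * ε) := by simp [mul_comm]
    _ ≤ ∫ y in Metric.closedBall x ε, |g y| := by
        refine setIntegral_mono_on (integrable_const _).integrableOn
          (integrable_abs_coe g).integrableOn measurableSet_closedBall fun y hy => ?_
        have h1 := hg x y
        have h2 : K * dist x y ≤ K * ε :=
          mul_le_mul_of_nonneg_left (by rw [dist_comm]; exact hy) hK
        have h3 := abs_sub_abs_le_abs_sub (g x) (g y)
        linarith
    _ ≤ ∫ y, |g y| := setIntegral_le_integral (integrable_abs_coe g)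
        (Filter.Eventually.of_forall fun y => abs_nonneg _)

/-- A probability density that is Lipschitz continuous with constant `A`. -/
structure IsLipDensity (A : ℝ) (g : C(UnitAddCircle, ℝ)) : Prop where
  nonneg : ∀ x, 0 ≤ g x
  integral_eq : ∫ x, g x = 1
  isLip : IsLip A g

theorem isLipDensity_one {A : ℝ} (hA : 0 ≤ A) : IsLipDensity A 1 :=
  ⟨fun x => by simp, by simp, isLip_one.mono hA⟩

/-! ### Abstract Doeblin operators: contraction, invariant density, decay -/

section Markov

variable {P : C(UnitAddCircle, ℝ) →ₗ[ℝ] C(UnitAddCircle, ℝ)}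

/-- A positive linear operator that preserves the integral. -/
structure IsMarkov (P : C(UnitAddCircle, ℝ) →ₗ[ℝ] C(UnitAddCircle, ℝ)) : Prop where
  nonneg : ∀ g, (∀ x, 0 ≤ g x) → ∀ x, 0 ≤ P g x
  integral : ∀ g, ∫ x, P g x = ∫ x, g x

theorem IsMarkov.pow (hP : IsMarkov P) (n : ℕ) : IsMarkov (P ^ n) := by
  induction n with
  | zero => exact ⟨fun g hg => hg, fun g => rfl⟩
  | succ n ih =>
    refine ⟨fun g hg => ?_, fun g => ?_⟩
    · rw [pow_succ', Module.End.mul_apply]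
      exact hP.nonneg _ (ih.nonneg g hg)
    · rw [pow_succ', Module.End.mul_apply, hP.integral, ih.integral]

theorem IsMarkov.integral_abs_le (hP : IsMarkov P) (g : C(UnitAddCircle, ℝ)) :
    ∫ x, |P g x| ≤ ∫ x, |g x| := by
  have h1 : ∀ x, |P g x| ≤ P |g| x := fun x => by
    have a := hP.nonneg (|g| - g) (fun y => by simp [le_abs_self]) x
    have b := hP.nonneg (|g| + g) (fun y => by
      simp only [ContinuousMap.add_apply, ContinuousMap.abs_apply]
      linarith [neg_abs_le (g y)]) x
    rw [map_sub, ContinuousMap.sub_apply] at a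
    rw [map_add, ContinuousMap.add_apply] at b
    exact _root_.abs_le.2 ⟨by linarith, by linarith⟩
  calc ∫ x, |P g x| ≤ ∫ x, P |g| x := integral_mono (integrable_abs_coe _) (integrable_coe _) h1
    _ = ∫ x, |g x| := by rw [hP.integral]; simp only [ContinuousMap.abs_apply]

/-- A Markov operator some power of which contracts Lipschitz constants of densities and
satisfies a Doeblin minorization. -/
structure IsDoeblin (P : C(UnitAddCircle, ℝ) →ₗ[ℝ] C(UnitAddCircle, ℝ)) (N : ℕ) (A c : ℝ) :
    Prop extends IsMarkov P where
  pos : 0 < N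
  one_le : 1 ≤ A
  c_pos : 0 < c
  c_le : c ≤ 1 / 4
  isLip : ∀ g, IsLipDensity A g → IsLip (3 / 4 * A) ((P ^ N) g)
  le : ∀ g, IsLipDensity A g → ∀ x, c ≤ (P ^ N) g x
  exists_isLip : ∀ g K, 0 ≤ K → IsLip K g → ∃ K', 0 ≤ K' ∧ IsLip K' (P g)

namespace IsDoeblin

variable {N : ℕ} {A c : ℝ}

theorem isLipDensity_pow (hP : IsDoeblin P N A c) {g : C(UnitAddCircle, ℝ)}
    (hg : IsLipDensity A g) (k : ℕ) : IsLipDensity A ((P ^ (N * k)) g) := by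
  induction k with
  | zero => simpa using hg
  | succ k ih =>
    have hm := hP.toIsMarkov.pow N
    rw [Nat.mul_succ, add_comm, pow_add, Module.End.mul_apply]
    exact ⟨hm.nonneg _ ih.nonneg, (hm.integral _).trans ih.integral_eq,
      (hP.isLip _ ih).mono (by linarith [hP.one_le])⟩

/-- After removal of the common mass `c`, renormalizing multiplies the Lipschitz constant by `1 / (1
- c)`; since `c ≤ 1 / 4`, this takes `3 A / 4` back to at most `A`. -/
theorem exists_residual (hP : IsDoeblin P N A c) {g : C(UnitAddCircle, ℝ)}
    (hg : IsLipDensity A g) :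
    ∃ g', IsLipDensity A g' ∧ (P ^ N) g = c • 1 + (1 - c) • g' := by
  have hc := hP.c_le
  have hc1 : 0 < 1 - c := by linarith
  refine ⟨(1 - c)⁻¹ • ((P ^ N) g - c • 1), ⟨fun x => ?_, ?_, ?_⟩, ?_⟩
  · have := hP.le g hg x
    simp only [ContinuousMap.smul_apply, ContinuousMap.sub_apply, ContinuousMap.one_apply,
      smul_eq_mul, mul_one]
    exact mul_nonneg (inv_nonneg.2 hc1.le) (by linarith)
  · simp only [ContinuousMap.smul_apply, ContinuousMap.sub_apply, ContinuousMap.one_apply,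
      smul_eq_mul, mul_one]
    rw [integral_const_mul, integral_sub (integrable_coe _) (integrable_const _),
      (hP.toIsMarkov.pow N).integral, hg.integral_eq]
    simp [hc1.ne']
  · refine (((hP.isLip g hg).sub (isLip_one.smul c)).smul (1 - c)⁻¹).mono ?_
    rw [abs_of_pos (inv_pos.2 hc1), mul_zero, add_zero, inv_mul_le_iff₀ hc1]
    nlinarith [hP.one_le]
  · rw [smul_smul, mul_inv_cancel₀ hc1.ne', one_smul, add_sub_cancel]

/-- In each block of `N` steps both densities acquire the same constant part `c`, which cancels, and
the residuals lie in the same class again. -/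
theorem integral_abs_sub_le (hP : IsDoeblin P N A c) (k : ℕ) {f g : C(UnitAddCircle, ℝ)}
    (hf : IsLipDensity A f) (hg : IsLipDensity A g) :
    ∫ x, |(P ^ (N * k)) f x - (P ^ (N * k)) g x| ≤ 2 * (1 - c) ^ k := by
  induction k generalizing f g with
  | zero =>
    have h1 : ∀ x, |f x - g x| ≤ f x + g x := fun x =>
      _root_.abs_le.2 ⟨by linarith [hf.nonneg x], by linarith [hg.nonneg x]⟩
    have := integral_mono (integrable_abs_coe (f - g))
      ((integrable_coe f).add (integrable_coe g)) h1
    simp only [Pi.add_apply] at this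
    rw [integral_add (integrable_coe f) (integrable_coe g), hf.integral_eq, hg.integral_eq] at this
    simpa [one_add_one_eq_two] using this
  | succ k ih =>
    obtain ⟨f', hf', ef⟩ := hP.exists_residual hf
    obtain ⟨g', hg', eg⟩ := hP.exists_residual hg
    have hc1 : 0 < 1 - c := by linarith [hP.c_le]
    have e : ∀ x, |(P ^ (N * (k + 1))) f x - (P ^ (N * (k + 1))) g x| =
        (1 - c) * |(P ^ (N * k)) f' x - (P ^ (N * k)) g' x| := fun x => by
      rw [Nat.mul_succ, pow_add, Module.End.mul_apply, Module.End.mul_apply, ef, eg]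
      simp only [map_add, map_smul, ContinuousMap.add_apply, ContinuousMap.smul_apply, smul_eq_mul]
      rw [add_sub_add_left_eq_sub, ← mul_sub, abs_mul, abs_of_pos hc1]
    simp_rw [e]
    rw [integral_const_mul, pow_succ]
    nlinarith [ih hf' hg']

theorem exists_rate (hP : IsDoeblin P N A c) :
    ∃ θ, 0 < θ ∧ θ < 1 ∧ ∃ C, 0 < C ∧ ∀ n, 2 * (1 - c) ^ (n / N) ≤ C * θ ^ n := by
  have hc1 : 0 < 1 - c := by linarith [hP.c_le]
  have hN : N ≠ 0 := hP.pos.ne'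
  set θ := (1 - c) ^ ((N : ℝ)⁻¹) with hθ
  have hθN : θ ^ N = 1 - c := Real.rpow_inv_natCast_pow hc1.le hN
  have hθ0 : 0 < θ := Real.rpow_pos_of_pos hc1 _
  have hθ1 : θ < 1 := Real.rpow_lt_one hc1.le (by linarith [hP.c_pos])
    (inv_pos.2 (by exact_mod_cast hP.pos))
  -- The incomplete last block in `n / N` costs one factor `1 / (1 - c)`.
  refine ⟨θ, hθ0, hθ1, 2 / (1 - c), by positivity, fun n => ?_⟩
  have h1 : (1 - c) ^ (n / N) * (1 - c) ≤ θ ^ n := by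
    rw [← pow_succ, ← hθN, ← pow_mul]
    refine pow_le_pow_of_le_one hθ0.le hθ1.le ?_
    exact (Nat.lt_mul_div_succ n hP.pos).le
  rw [div_mul_eq_mul_div, le_div_iff₀ hc1]
  linarith

theorem exists_decay (hP : IsDoeblin P N A c) :
    ∃ θ, 0 < θ ∧ θ < 1 ∧ ∃ C, 0 < C ∧ ∀ (h : C(UnitAddCircle, ℝ)) (K : ℝ), 0 ≤ K → IsLip K h →
      ∫ x, h x = 0 → ∀ n, ∫ x, |(P ^ n) h x| ≤ C * K * θ ^ n := by
  obtain ⟨θ, hθ0, hθ1, C, hC, hrate⟩ := hP.exists_rate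
  refine ⟨θ, hθ0, hθ1, C, hC, fun h K hK hL h0 n => ?_⟩
  have habs := hL.abs_le_of_integral_eq_zero hK h0
  rcases hK.eq_or_lt with rfl | hK
  · have : h = 0 := by
      ext x
      exact abs_nonpos_iff.1 (habs x)
    simp [this]
  -- Mean zero and diameter at most one give `|h| ≤ K`, so `1 + h / K` is a density with Lipschitz
  -- constant `1 ≤ A`, which can be compared with the density `1`.
  have hu : IsLipDensity A (1 + K⁻¹ • h) := by
    refine ⟨fun x => ?_, ?_, ?_⟩
    · simp only [ContinuousMap.add_apply, ContinuousMap.one_apply, ContinuousMap.smul_apply,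
        smul_eq_mul]
      have h1 := (_root_.abs_le.1 (habs x)).1
      have h2 : K⁻¹ * (-K) ≤ K⁻¹ * h x := mul_le_mul_of_nonneg_left h1 (inv_nonneg.2 hK.le)
      have h3 : K⁻¹ * (-K) = -1 := by field_simp
      linarith
    · simp only [ContinuousMap.add_apply, ContinuousMap.one_apply, ContinuousMap.smul_apply,
        smul_eq_mul]
      rw [integral_add (integrable_const _) ((integrable_coe h).const_mul _), integral_const_mul,
        h0]
      simp
    · refine (isLip_one.add (hL.smul K⁻¹)).mono ?_
      rw [abs_of_pos (inv_pos.2 hK), inv_mul_cancel₀ hK.ne', zero_add]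
      exact hP.one_le
  have h1 := hP.integral_abs_sub_le (n / N) hu (isLipDensity_one (by linarith [hP.one_le]))
  have hP' := (hP.toIsMarkov.pow (n % N)).integral_abs_le
    ((P ^ (N * (n / N))) (1 + K⁻¹ • h) - (P ^ (N * (n / N))) 1)
  have e : (P ^ (n % N)) ((P ^ (N * (n / N))) (1 + K⁻¹ • h) - (P ^ (N * (n / N))) 1) =
      K⁻¹ • (P ^ n) h := by
    rw [← map_sub, ← Module.End.mul_apply, ← pow_add, Nat.mod_add_div, add_sub_cancel_left,
      map_smul]
  rw [e] at hP'
  simp only [ContinuousMap.smul_apply, smul_eq_mul, abs_mul, abs_of_pos (inv_pos.2 hK)] at hP'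
  rw [integral_const_mul, inv_mul_le_iff₀ hK] at hP'
  calc _ ≤ _ := hP'
    _ ≤ K * (C * θ ^ n) := mul_le_mul_of_nonneg_left (h1.trans (hrate n)) hK.le
    _ = _ := by ring

theorem exists_tendsto (hP : IsDoeblin P N A c) :
    ∃ φ, Filter.Tendsto (fun k => (P ^ (N * k)) 1) Filter.atTop (nhds φ) := by
  have hA := hP.one_le
  have hc1 : 0 < 1 - c := by linarith [hP.c_le]
  have h1 : IsLipDensity A 1 := isLipDensity_one (by linarith)
  -- Interpolation at scale `ρ ^ k` balances the Lipschitz term `2 A ρ ^ k` with the `L¹` term `2 (1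
  -- - c) ^ k / ρ ^ k = 2 ρ ^ k`, so the `L¹` decay becomes uniform.
  set ρ := Real.sqrt (1 - c) with hρ
  have hρ2 : ρ ^ 2 = 1 - c := Real.sq_sqrt hc1.le
  have hρ0 : 0 < ρ := Real.sqrt_pos.2 hc1
  have hρ1 : ρ < 1 := by nlinarith [hP.c_pos]
  refine cauchySeq_tendsto_of_complete (cauchySeq_of_le_tendsto_0 (fun k => (2 * A + 2) * ρ ^ k)
    (fun n m k hn hm => ?_) ?_)
  · rw [ContinuousMap.dist_le (by positivity)]
    intro x
    have hlip := (hP.isLipDensity_pow h1 n).isLip.sub (hP.isLipDensity_pow h1 m).isLip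
    have hb := hlip.abs_le (by linarith) (pow_pos hρ0 k) (pow_le_one₀ hρ0.le hρ1.le) x
    have hs := hP.integral_abs_sub_le k (hP.isLipDensity_pow h1 (n - k))
      (hP.isLipDensity_pow h1 (m - k))
    simp only [← Module.End.mul_apply, ← pow_add, ← mul_add, Nat.add_sub_cancel' hn,
      Nat.add_sub_cancel' hm] at hs
    rw [Real.dist_eq]
    have hs' : (∫ y, |((P ^ (N * n)) 1 - (P ^ (N * m)) 1) y|) / ρ ^ k ≤ 2 * ρ ^ k := by
      rw [div_le_iff₀ (pow_pos hρ0 k)]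
      refine hs.trans_eq ?_
      rw [← hρ2]
      ring
    calc _ ≤ _ := hb
      _ ≤ (A + A) * ρ ^ k + 2 * ρ ^ k := add_le_add_right hs' _
      _ = _ := by ring
  · simpa using (tendsto_pow_atTop_nhds_zero_of_lt_one hρ0.le hρ1).const_mul (2 * A + 2)

/-- The uniform limit along multiples of `N` is fixed by `P ^ N`. Then `P φ - φ` is Lipschitz, has
mean zero and is also fixed by `P ^ N`, so the decay estimate makes it vanish. The lower bound comes
from `φ = P ^ N φ`. -/
theorem exists_invariant (hP : IsDoeblin P N A c) :
    ∃ φ, P φ = φ ∧ IsLipDensity A φ ∧ ∀ x, c ≤ φ x := by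
  have hA := hP.one_le
  have h1 : IsLipDensity A 1 := isLipDensity_one (by linarith)
  obtain ⟨φ, hφ⟩ := hP.exists_tendsto
  have hdist : Filter.Tendsto (fun k => ‖(P ^ (N * k)) 1 - φ‖) Filter.atTop (nhds 0) :=
    tendsto_iff_norm_sub_tendsto_zero.1 hφ
  have hpt : ∀ x, Filter.Tendsto (fun k => (P ^ (N * k)) 1 x) Filter.atTop (nhds (φ x)) := fun x =>
    ((continuous_eval_const x).tendsto φ).comp hφ
  have hdens : IsLipDensity A φ := by
    refine ⟨fun x => ge_of_tendsto' (hpt x) fun k => (hP.isLipDensity_pow h1 k).nonneg x, ?_,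
      fun x y => le_of_tendsto' ((hpt x).sub (hpt y)).abs
        fun k => (hP.isLipDensity_pow h1 k).isLip x y⟩
    have hle : ∀ k, |1 - ∫ x, φ x| ≤ ‖(P ^ (N * k)) 1 - φ‖ := fun k => by
      have e : 1 - ∫ x, φ x = ∫ x, ((P ^ (N * k)) 1 x - φ x) := by
        rw [integral_sub (integrable_coe _) (integrable_coe _),
          (hP.isLipDensity_pow h1 k).integral_eq]
      rw [e]
      exact abs_integral_le_integral_abs.trans (integral_abs_le_norm ((P ^ (N * k)) 1 - φ))
    have := abs_nonpos_iff.1 (ge_of_tendsto' hdist hle)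
    linarith
  have hN : (P ^ N) φ = φ := by
    rw [← sub_eq_zero]
    refine eq_zero_of_integral_abs_le_zero (ge_of_tendsto'
      (by simpa using hdist.add (hdist.comp (Filter.tendsto_add_atTop_nat 1))) fun k => ?_)
    -- The `L¹` contraction of `P ^ N` is what passes to the limit.
    have e : (P ^ N) φ - φ = (P ^ N) (φ - (P ^ (N * k)) 1) + ((P ^ (N * (k + 1))) 1 - φ) := by
      rw [map_sub, Nat.mul_succ, add_comm (N * k), pow_add, Module.End.mul_apply]
      abel
    rw [e]
    refine (integral_abs_add_le _ _).trans (add_le_add ?_ (integral_abs_le_norm _))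
    refine ((hP.toIsMarkov.pow N).integral_abs_le _).trans ((integral_abs_le_norm _).trans_eq ?_)
    exact norm_sub_rev _ _
  refine ⟨φ, ?_, hdens, fun x => hN ▸ hP.le φ hdens x⟩
  obtain ⟨θ, hθ0, hθ1, C, hC, hdecay⟩ := hP.exists_decay
  obtain ⟨K, hK, hPφ⟩ := hP.exists_isLip φ A (by linarith) hdens.isLip
  have hNk : ∀ k, (P ^ (N * k)) (P φ - φ) = P φ - φ := fun k => by
    induction k with
    | zero => simp
    | succ k ih =>
      rw [Nat.mul_succ, pow_add, Module.End.mul_apply]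
      have : (P ^ N) (P φ - φ) = P φ - φ := by
        rw [map_sub, hN, ← Module.End.mul_apply, (Commute.refl P).pow_left N, Module.End.mul_apply, hN]
      rw [this, ih]
  rw [← sub_eq_zero]
  have hint : ∫ x, (P φ - φ) x = 0 := by
    simp only [ContinuousMap.sub_apply]
    rw [integral_sub (integrable_coe _) (integrable_coe _), hP.integral, sub_self]
  have hlim : Filter.Tendsto (fun k => C * (K + A) * (θ ^ N) ^ k) Filter.atTop (nhds 0) := by
    simpa using (tendsto_pow_atTop_nhds_zero_of_lt_one (pow_nonneg hθ0.le N)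
      (pow_lt_one₀ hθ0.le hθ1 hP.pos.ne')).const_mul (C * (K + A))
  refine eq_zero_of_integral_abs_le_zero (ge_of_tendsto' hlim fun k => ?_)
  have := hdecay (P φ - φ) (K + A) (by linarith) (hPφ.sub hdens.isLip) hint (N * k)
  rwa [hNk, pow_mul] at this

end IsDoeblin

end Markov

/-! ### The random circle system is Doeblin -/

/-- A density is at least its mean `1` somewhere, and it drops by at most `1 / 2` over the distance
`1 / (2 A)`. -/
theorem IsLipDensity.exists_arc {A : ℝ} (hA : 0 < A) {g : C(UnitAddCircle, ℝ)}
    (hg : IsLipDensity A g) :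
    ∃ t₀ : ℝ, ∀ t ∈ Set.Icc t₀ (t₀ + 1 / (2 * A)), 1 / 2 ≤ g (t : UnitAddCircle) := by
  obtain ⟨x, hx⟩ := exists_integral_le (integrable_coe g)
  obtain ⟨t₀, rfl⟩ := QuotientAddGroup.mk_surjective x
  refine ⟨t₀, fun t ht => ?_⟩
  rw [hg.integral_eq] at hx
  have h1 := hg.isLip (t₀ : UnitAddCircle) (t : UnitAddCircle)
  have h2 : A * dist (t₀ : UnitAddCircle) (t : UnitAddCircle) ≤ A * (1 / (2 * A)) := by
    refine mul_le_mul_of_nonneg_left ((dist_coe_le _ _).trans ?_) hA.le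
    rw [abs_sub_comm, abs_of_nonneg (by linarith [ht.1])]
    linarith [ht.2]
  have h3 : A * (1 / (2 * A)) = 1 / 2 := by field_simp
  have h4 := (_root_.abs_le.1 (h1.trans h2)).2
  have h5 : (1 : ℝ) ≤ g (t₀ : UnitAddCircle) := hx
  linarith

namespace SystemBounds

variable {Ω : Type*} [MeasurableSpace Ω] {η : Measure Ω} [IsProbabilityMeasure η]
  {T : Ω → UnitAddCircle → UnitAddCircle} {l D M : Ω → ℝ}

theorem isMarkov_op (h : SystemBounds η T l D M) : IsMarkov h.op :=
  ⟨fun _ hg => h.op_nonneg hg, h.integral_op⟩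

/-- Weighted arithmetic–geometric inequality: when `E l²` is tiny and `E D²` merely bounded, a
suitable `t` makes the left side small. -/
theorem integral_l_add_le (h : SystemBounds η T l D M) {t : ℝ} (ht : 0 < t) :
    ∫ ω, l ω ∂η + ∫ ω, l ω * D ω ∂η ≤
      t / 2 * (1 + ∫ ω, D ω ^ 2 ∂η) + (∫ ω, l ω ^ 2 ∂η) / t := by
  have h1D : Integrable (fun ω => 1 + D ω ^ 2) η := (integrable_const _).add h.integrable_D
  have hi : Integrable (fun ω => t / 2 * (1 + D ω ^ 2) + l ω ^ 2 / t) η :=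
    (h1D.const_mul _).add (h.integrable_l.div_const _)
  have e : ∫ ω, (t / 2 * (1 + D ω ^ 2) + l ω ^ 2 / t) ∂η =
      t / 2 * (1 + ∫ ω, D ω ^ 2 ∂η) + (∫ ω, l ω ^ 2 ∂η) / t := by
    rw [integral_add (h1D.const_mul _) (h.integrable_l.div_const _), integral_const_mul,
      integral_add (integrable_const _) h.integrable_D, integral_div]
    simp
  rw [← integral_add h.integrable_l_one h.integrable_l_mul_D, ← e]
  refine integral_mono (h.integrable_l_one.add h.integrable_l_mul_D) hi fun ω => ?_
  have key : t / 2 * (1 + D ω ^ 2) + l ω ^ 2 / t - (l ω + l ω * D ω) =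
      ((t - l ω) ^ 2 + (t * D ω - l ω) ^ 2) / (2 * t) := by
    field_simp
    ring
  have : 0 ≤ ((t - l ω) ^ 2 + (t * D ω - l ω) ^ 2) / (2 * t) := by positivity
  change l ω + l ω * D ω ≤ _
  linarith

theorem integral_D_add_le (h : SystemBounds η T l D M) :
    ∫ ω, D ω ∂η + ∫ ω, D ω ^ 2 ∂η ≤ 1 + 2 * ∫ ω, D ω ^ 2 ∂η := by
  have : ∫ ω, D ω ∂η ≤ ∫ ω, (1 + D ω ^ 2) ∂η :=
    integral_mono h.integrable_D_one ((integrable_const _).add h.integrable_D) fun ω => by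
      change D ω ≤ 1 + D ω ^ 2
      nlinarith [sq_nonneg (D ω - 1)]
  rw [integral_add (integrable_const _) h.integrable_D] at this
  simp at this
  linarith

theorem isLip_op (h : SystemBounds η T l D M) {g : C(UnitAddCircle, ℝ)} {K S a b : ℝ}
    (hK : 0 ≤ K) (hS : ∀ x, |g x| ≤ S) (hg : IsLip K g)
    (ha : ∫ ω, l ω ∂η + ∫ ω, l ω * D ω ∂η ≤ a) (hb : ∫ ω, D ω ∂η + ∫ ω, D ω ^ 2 ∂η ≤ b) :
    IsLip (K * a + S * b) (h.op g) := fun x y => by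
  have hS0 : 0 ≤ S := (abs_nonneg _).trans (hS 0)
  refine (h.abs_op_sub_le hS hK hg x y).trans (mul_le_mul_of_nonneg_right ?_ dist_nonneg)
  gcongr

theorem exists_isDoeblin (h : SystemBounds η T l D M) (hq : ∫ ω, l ω ^ 2 ∂η < 1) :
    ∃ N A c, IsDoeblin h.op N A c := by
  obtain ⟨K, hK⟩ := h.exists_iterate hq
  have hK0 : 0 ≤ K := by
    obtain ⟨Ω', _, η', _, T', l', D', M', h', -, -, h3⟩ := hK 0
    exact (integral_nonneg fun ω => sq_nonneg (D' ω)).trans h3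
  have hq0 : 0 ≤ ∫ ω, l ω ^ 2 ∂η := integral_nonneg fun ω => sq_nonneg _
  set b := 1 + 2 * K with hb
  have hb1 : 1 ≤ b := by linarith
  -- Chosen so that `4 b² = A / 4`.
  set A := 16 * b ^ 2 with hA
  have hA1 : 1 ≤ A := by nlinarith
  -- Chosen so that `t / 2 * (1 + K) = 1 / 8`; the other `1 / 8` comes from `E l'² < t / 8 * 1`,
  -- divided by `t`.
  set t := 1 / (4 * (1 + K)) with ht
  have ht0 : 0 < t := by positivity
  obtain ⟨n, hn⟩ : ∃ n : ℕ, (∫ ω, l ω ^ 2 ∂η) ^ (n + 1) < min (t / 8) ((1 / (2 * A)) ^ 2) := by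
    obtain ⟨n, hn⟩ := exists_pow_lt_of_lt_one
      (show 0 < min (t / 8) ((1 / (2 * A)) ^ 2) by positivity) hq
    exact ⟨n, (pow_le_pow_of_le_one hq0 hq.le n.le_succ).trans_lt hn⟩
  obtain ⟨Ω', _, η', _, T', l', D', M', h', hop, hl', hD'⟩ := hK n
  have hla : ∫ ω, l' ω ∂η' + ∫ ω, l' ω * D' ω ∂η' ≤ 1 / 4 := by
    refine (h'.integral_l_add_le ht0).trans ?_
    have h1 : (∫ ω, l' ω ^ 2 ∂η') / t ≤ 1 / 8 := by
      rw [div_le_iff₀ ht0, hl']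
      linarith [hn.le.trans (min_le_left _ _)]
    have h2 : t / 2 * (1 + ∫ ω, D' ω ^ 2 ∂η') ≤ t / 2 * (1 + K) := by gcongr
    have h3 : t / 2 * (1 + K) = 1 / 8 := by
      rw [ht]
      field_simp
      norm_num
    linarith
  have hDb : ∫ ω, D' ω ∂η' + ∫ ω, D' ω ^ 2 ∂η' ≤ b := h'.integral_D_add_le.trans (by linarith)
  obtain ⟨c, hc, hle⟩ := h'.le_op (r := 1 / (2 * A))
    (hl' ▸ hn.trans_le (min_le_right _ _)) (by positivity)
  refine ⟨n + 1, A, min (1 / 2 * c) (1 / 4), h.isMarkov_op, n.succ_pos, hA1, by positivity,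
    min_le_right _ _, fun g hg => ?_, fun g hg x => ?_, fun g L hL hg => ?_⟩
  -- With `ε = 1 / (4 b)` the sup norm is at most `A / (4 b) + 4 b`, so the new Lipschitz constant
  -- is `A / 4 + A / 4 + 4 b² = 3 A / 4`.
  · have hS := hg.isLip.abs_le (by linarith) (ε := 1 / (4 * b)) (by positivity)
      (by rw [div_le_one (by positivity)]; linarith)
    have hI : ∫ y, |g y| = 1 := by
      simp_rw [fun y => abs_of_nonneg (hg.nonneg y)]
      exact hg.integral_eq
    rw [hI] at hS
    rw [← hop]
    refine (h'.isLip_op (by linarith) hS hg.isLip hla hDb).mono (le_of_eq ?_)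
    rw [hA]
    field_simp
    ring
  · rw [← hop]
    obtain ⟨t₀, ht₀⟩ := hg.exists_arc (by linarith)
    exact (min_le_left _ _).trans (hle g hg.nonneg (1 / 2) t₀ (by norm_num) ht₀ x)
  · have h0 : 0 ≤ ∫ ω, l ω ∂η + ∫ ω, l ω * D ω ∂η := add_nonneg
      (integral_nonneg fun ω => (h.bounds ω).nonneg.1.le)
      (integral_nonneg fun ω => mul_nonneg (h.bounds ω).nonneg.1.le (h.bounds ω).nonneg.2.1)
    have h1 : 0 ≤ ∫ ω, D ω ∂η + ∫ ω, D ω ^ 2 ∂η := add_nonneg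
      (integral_nonneg fun ω => (h.bounds ω).nonneg.2.1) (integral_nonneg fun ω => sq_nonneg _)
    exact ⟨_, by positivity, h.isLip_op hL g.norm_coe_le_norm hg le_rfl le_rfl⟩

end SystemBounds

/-! ### From Lipschitz to Hölder functions -/

/-- The infimal convolution of `ψ` with `K * dist` is `K`-Lipschitz and lies below `ψ`. With `K = H
ε ^ (α - 1)`, points farther than `ε` never help, since there `H d ^ α ≤ K d`; nearer ones gain at
most `H ε ^ α`. -/
theorem exists_isLip_approx {ψ : C(UnitAddCircle, ℝ)} {H α ε : ℝ} (hH : 0 ≤ H) (hα0 : 0 < α)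
    (hα1 : α < 1) (hψ : ∀ x y, |ψ x - ψ y| ≤ H * dist x y ^ α) (hε : 0 < ε) :
    ∃ h : C(UnitAddCircle, ℝ), IsLip (H * ε ^ (α - 1)) h ∧ ∀ x, |ψ x - h x| ≤ H * ε ^ α := by
  set K := H * ε ^ (α - 1) with hK
  have hK0 : 0 ≤ K := by positivity
  have hbdd : ∀ x, BddBelow (Set.range fun y => ψ y + K * dist x y) := fun x => by
    refine ⟨-‖ψ‖, ?_⟩
    rintro _ ⟨y, rfl⟩
    have h1 := ψ.neg_norm_le_apply y
    have h2 : 0 ≤ K * dist x y := by positivity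
    simp only
    linarith
  set h : UnitAddCircle → ℝ := fun x => ⨅ y, (ψ y + K * dist x y) with hh
  have hle : ∀ x x', h x - K * dist x x' ≤ h x' := fun x x' => by
    refine le_ciInf fun y => ?_
    have h1 : h x ≤ ψ y + K * dist x y := ciInf_le (hbdd x) y
    have h2 : K * dist x y ≤ K * (dist x x' + dist x' y) :=
      mul_le_mul_of_nonneg_left (dist_triangle _ _ _) hK0
    linarith
  have hlip : ∀ x y, |h x - h y| ≤ K * dist x y := fun x y => by
    have h1 := hle x y
    have h2 := hle y x
    rw [dist_comm y x] at h2
    exact abs_le.2 ⟨by linarith, by linarith⟩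
  have hcont : Continuous h :=
    (LipschitzWith.of_dist_le_mul (K := ⟨K, hK0⟩) fun x y => hlip x y).continuous
  refine ⟨⟨h, hcont⟩, hlip, fun x => ?_⟩
  have h1 : h x ≤ ψ x := by
    have := ciInf_le (hbdd x) x
    simpa using this
  have h2 : ψ x - H * ε ^ α ≤ h x := by
    refine le_ciInf fun y => ?_
    have h3 := (abs_le.1 (hψ x y)).2
    suffices H * dist x y ^ α ≤ H * ε ^ α + K * dist x y by linarith
    rcases le_or_gt (dist x y) ε with hd | hd
    · have : H * dist x y ^ α ≤ H * ε ^ α := by gcongr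
      have : 0 ≤ K * dist x y := by positivity
      linarith
    · have hd0 : 0 < dist x y := hε.trans hd
      have h4 : dist x y ^ (α - 1) ≤ ε ^ (α - 1) :=
        Real.rpow_le_rpow_of_nonpos hε hd.le (by linarith)
      have h5 : dist x y ^ α = dist x y ^ (α - 1) * dist x y := by
        rw [Real.rpow_sub_one hd0.ne']
        field_simp
      have h6 : 0 ≤ H * ε ^ α := by positivity
      rw [h5, hK, mul_assoc]
      have : H * (dist x y ^ (α - 1) * dist x y) ≤ H * (ε ^ (α - 1) * dist x y) := by gcongr
      linarith
  change |ψ x - h x| ≤ _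
  rw [abs_of_nonneg (by linarith)]
  linarith

theorem IsDoeblin.exists_holder_decay {P : C(UnitAddCircle, ℝ) →ₗ[ℝ] C(UnitAddCircle, ℝ)} {N : ℕ}
    {A c : ℝ} (hP : IsDoeblin P N A c) {φ : C(UnitAddCircle, ℝ)} (hPφ : P φ = φ)
    (hφ : IsLipDensity A φ) :
    ∃ θ, 0 < θ ∧ θ < 1 ∧ ∃ C, 0 < C ∧ ∀ (ψ : C(UnitAddCircle, ℝ)) (H S α : ℝ), 0 ≤ H → 0 < α →
      α < 1 → (∀ x y, |ψ x - ψ y| ≤ H * dist x y ^ α) → (∀ x, |ψ x| ≤ S) → ∀ n : ℕ,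
      ∫ x, |(P ^ n) ψ x - (∫ y, ψ y) * φ x| ≤ C * (H + S) * θ ^ (α * n) := by
  obtain ⟨θ, hθ0, hθ1, C, hC, hdecay⟩ := hP.exists_decay
  have hA := hP.one_le
  refine ⟨θ, hθ0, hθ1, 2 + C + C * A, by positivity, fun ψ H S α hH hα0 hα1 hψ hS n => ?_⟩
  have hS0 : 0 ≤ S := (abs_nonneg _).trans (hS 0)
  -- At this scale the approximation error is `H ε ^ α`, and the Lipschitz constant `H ε ^ (α - 1)`
  -- times the decay `θ ^ n = ε` is also `H ε ^ α`. Neither `θ` nor the constant depends on `α`.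
  set ε := θ ^ n with hε
  have hε0 : 0 < ε := pow_pos hθ0 n
  have hε1 : ε ≤ 1 := pow_le_one₀ hθ0.le hθ1.le
  have hεα : θ ^ (α * n) = ε ^ α := by
    rw [hε, mul_comm, Real.rpow_mul hθ0.le, Real.rpow_natCast]
  have hεα1 : ε ^ α ≤ 1 := Real.rpow_le_one hε0.le hε1 hα0.le
  have hεle : ε ≤ ε ^ α := by
    simpa using Real.rpow_le_rpow_of_exponent_ge hε0 hε1 hα1.le
  have hεsub : ε ^ (α - 1) * ε = ε ^ α := by
    rw [Real.rpow_sub_one hε0.ne']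
    field_simp
  obtain ⟨h, hlip, happ⟩ := exists_isLip_approx hH hα0 hα1 hψ hε0
  have hφn : (P ^ n) φ = φ := (Module.End.pow_apply P n φ).trans (Function.iterate_fixed hPφ n)
  have hψh : ∫ x, |(ψ - h) x| ≤ H * ε ^ α := by
    have := integral_mono (integrable_abs_coe (ψ - h)) (integrable_const (H * ε ^ α)) happ
    simpa using this
  have hdiff : |(∫ x, h x) - ∫ x, ψ x| ≤ H * ε ^ α := by
    rw [abs_sub_comm, ← integral_sub (integrable_coe _) (integrable_coe _)]
    exact abs_integral_le_integral_abs.trans hψh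
  have hψS : |∫ x, ψ x| ≤ S := by
    have := norm_integral_le_of_norm_le_const (μ := (volume : Measure UnitAddCircle)) (f := ψ)
      (Filter.Eventually.of_forall hS)
    simpa using this
  have hhS : |∫ x, h x| ≤ S + H := by
    have h1 := abs_sub_abs_le_abs_sub (∫ x, h x) (∫ x, ψ x)
    have h2 : H * ε ^ α ≤ H := mul_le_of_le_one_right hH hεα1
    linarith
  set m := ∫ x, h x with hm
  have e : ∀ x, (P ^ n) ψ x - (∫ y, ψ y) * φ x =
      ((P ^ n) (ψ - h) + ((P ^ n) (h - m • φ) + (m - ∫ y, ψ y) • φ)) x := fun x => by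
    rw [map_sub, map_sub, map_smul, hφn]
    simp only [ContinuousMap.add_apply, ContinuousMap.sub_apply, ContinuousMap.smul_apply,
      smul_eq_mul]
    ring
  simp_rw [e]
  have b1 : ∫ x, |(P ^ n) (ψ - h) x| ≤ H * ε ^ α :=
    ((hP.toIsMarkov.pow n).integral_abs_le _).trans hψh
  have b2 : ∫ x, |(P ^ n) (h - m • φ) x| ≤ C * (H * ε ^ (α - 1) + |m| * A) * ε := by
    refine hdecay _ _ (by positivity) (hlip.sub (hφ.isLip.smul m)) ?_ n
    simp only [ContinuousMap.sub_apply, ContinuousMap.smul_apply, smul_eq_mul]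
    rw [integral_sub (integrable_coe _) ((integrable_coe _).const_mul _), integral_const_mul,
      hφ.integral_eq, mul_one, sub_self]
  have b3 : ∫ x, |((m - ∫ y, ψ y) • φ) x| ≤ H * ε ^ α := by
    simp only [ContinuousMap.smul_apply, smul_eq_mul, abs_mul, fun x => abs_of_nonneg (hφ.nonneg x)]
    rw [integral_const_mul, hφ.integral_eq, mul_one]
    exact hdiff
  have b4 : C * (H * ε ^ (α - 1) + |m| * A) * ε ≤ C * H * ε ^ α + C * ((S + H) * A) * ε ^ α := by
    calc _ = C * H * (ε ^ (α - 1) * ε) + C * (|m| * A) * ε := by ring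
      _ ≤ _ := by
        rw [hεsub]
        gcongr
  refine (integral_abs_add_le _ _).trans ((add_le_add b1 ((integral_abs_add_le _ _).trans
    (add_le_add (b2.trans b4) b3))).trans ?_)
  rw [hεα]
  have h7 : 0 ≤ S * ε ^ α * (2 + C) := by positivity
  linarith

/-! ### Measurability in `ω`, and the bounds obtained from the hypotheses -/

section Measurability

variable {Ω X : Type*} [MeasurableSpace Ω] [TopologicalSpace X] [CompactSpace X]

theorem bddAbove_range_of_continuous {v : X → ℝ} (hv : Continuous v) :
    BddAbove (Set.range v) := (isCompact_range hv).bddAbove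

theorem bddBelow_range_of_continuous {v : X → ℝ} (hv : Continuous v) :
    BddBelow (Set.range v) := (isCompact_range hv).bddBelow

variable [Nonempty X] [TopologicalSpace.SeparableSpace X] {u : Ω → X → ℝ}

/-- By continuity the supremum is detected on a countable dense sequence. -/
theorem measurable_iSup_of_continuous (hc : ∀ ω, Continuous (u ω))
    (hm : ∀ x, Measurable fun ω => u ω x) : Measurable fun ω => ⨆ x, u ω x := by
  refine measurable_of_Ioi fun a => ?_
  have e : (fun ω => ⨆ x, u ω x) ⁻¹' Set.Ioi a =
      ⋃ n, {ω | a < u ω (TopologicalSpace.denseSeq X n)} := by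
    ext ω
    simp only [Set.mem_preimage, Set.mem_Ioi, Set.mem_iUnion, Set.mem_ofPred_eq]
    rw [lt_ciSup_iff (bddAbove_range_of_continuous (hc ω))]
    refine ⟨fun ⟨x, hx⟩ => ?_, fun ⟨n, hn⟩ => ⟨_, hn⟩⟩
    obtain ⟨_, hy, n, rfl⟩ := (TopologicalSpace.denseRange_denseSeq X).inter_open_nonempty
      {y | a < u ω y} (isOpen_lt continuous_const (hc ω)) ⟨x, hx⟩
    exact ⟨n, hy⟩
  rw [e]
  exact MeasurableSet.iUnion fun n => measurableSet_lt measurable_const (hm _)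

theorem measurable_iInf_of_continuous (hc : ∀ ω, Continuous (u ω))
    (hm : ∀ x, Measurable fun ω => u ω x) : Measurable fun ω => ⨅ x, u ω x := by
  refine measurable_of_Iio fun a => ?_
  have e : (fun ω => ⨅ x, u ω x) ⁻¹' Set.Iio a =
      ⋃ n, {ω | u ω (TopologicalSpace.denseSeq X n) < a} := by
    ext ω
    simp only [Set.mem_preimage, Set.mem_Iio, Set.mem_iUnion, Set.mem_ofPred_eq]
    rw [ciInf_lt_iff (bddBelow_range_of_continuous (hc ω))]
    refine ⟨fun ⟨x, hx⟩ => ?_, fun ⟨n, hn⟩ => ⟨_, hn⟩⟩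
    obtain ⟨_, hy, n, rfl⟩ := (TopologicalSpace.denseRange_denseSeq X).inter_open_nonempty
      {y | u ω y < a} (isOpen_lt (hc ω) continuous_const) ⟨x, hx⟩
    exact ⟨n, hy⟩
  rw [e]
  exact MeasurableSet.iUnion fun n => measurableSet_lt (hm _) measurable_const

end Measurability

theorem measurable_deriv_zero {Ω : Type*} [MeasurableSpace Ω] {u : Ω → ℝ → ℝ}
    (hd : ∀ ω, DifferentiableAt ℝ (u ω) 0) (hm : ∀ s, Measurable fun ω => u ω s) :
    Measurable fun ω => deriv (u ω) 0 := by
  have hlim : Filter.Tendsto (fun n : ℕ => 1 / ((n : ℝ) + 1)) Filter.atTop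
      (nhdsWithin 0 {0}ᶜ) :=
    tendsto_nhdsWithin_iff.2 ⟨tendsto_one_div_add_atTop_nhds_zero_nat,
      Filter.Eventually.of_forall fun n => by
        have : (0 : ℝ) < 1 / ((n : ℝ) + 1) := by positivity
        exact this.ne'⟩
  refine measurable_of_tendsto_metrizable (f := fun (n : ℕ) ω => (1 / ((n : ℝ) + 1))⁻¹ •
    (u ω (0 + 1 / ((n : ℝ) + 1)) - u ω 0)) (fun n => by
      have h1 := hm (0 + 1 / ((n : ℝ) + 1))
      have h2 := hm 0
      fun_prop)
    (tendsto_pi_nhds.2 fun ω => (hd ω).hasDerivAt.tendsto_slope_zero.comp hlim)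

theorem measurable_rep : Measurable rep :=
  measurable_subtype_coe.comp (AddCircle.measurableEquivIoc (1 : ℝ) (-1 / 2)).measurable

section Lift

variable {T : UnitAddCircle → UnitAddCircle}

theorem mapDeriv2_coe {F : ℝ → ℝ} (hF : Continuous F)
    (hT : ∀ t : ℝ, ((F t : ℝ) : UnitAddCircle) = T (t : UnitAddCircle)) (t : ℝ) :
    mapDeriv2 T (t : UnitAddCircle) = deriv (deriv F) t := by
  rw [mapDeriv2, scalarDeriv]
  simp_rw [← AddCircle.coe_add, mapDeriv_coe hF hT]
  rw [deriv_comp_const_add, add_zero]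

theorem contDiff_deriv_of_contDiff_two {F : ℝ → ℝ} (hF : ContDiff ℝ 2 F) : ContDiff ℝ 1 (deriv F) := by
  have : ContDiff ℝ (1 + 1) F := by simpa [one_add_one_eq_two] using hF
  exact (contDiff_succ_iff_deriv.1 this).2.2

theorem continuous_of_comp_coe {g : UnitAddCircle → ℝ} {u : ℝ → ℝ} (hu : Continuous u)
    (h : ∀ t : ℝ, g (t : UnitAddCircle) = u t) : Continuous g := by
  refine (QuotientAddGroup.isQuotientMap_mk (N := AddSubgroup.zmultiples (1 : ℝ))).continuous_iff.2 ?_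
  have : (g ∘ (QuotientAddGroup.mk : ℝ → UnitAddCircle)) = u := funext h
  exact this ▸ hu

theorem IsC2.continuous_mapDeriv (hT : IsC2 T) : Continuous (mapDeriv T) := by
  obtain ⟨F, hF, hlift⟩ := hT
  exact continuous_of_comp_coe (contDiff_deriv_of_contDiff_two hF).continuous
    (mapDeriv_coe hF.continuous hlift)

theorem IsC2.continuous_mapDeriv2 (hT : IsC2 T) : Continuous (mapDeriv2 T) := by
  obtain ⟨F, hF, hlift⟩ := hT
  exact continuous_of_comp_coe ((contDiff_deriv_of_contDiff_two hF).continuous_deriv (by norm_num))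
    (mapDeriv2_coe hF.continuous hlift)

theorem IsC2.differentiableAt_mapDeriv (hT : IsC2 T) (x : UnitAddCircle) :
    DifferentiableAt ℝ (fun s : ℝ => mapDeriv T (x + (s : UnitAddCircle))) 0 := by
  obtain ⟨F, hF, hlift⟩ := hT
  obtain ⟨t, rfl⟩ := QuotientAddGroup.mk_surjective x
  have e : (fun s : ℝ => mapDeriv T ((t : UnitAddCircle) + (s : UnitAddCircle))) =
      fun s => deriv F (t + s) := by
    ext s
    rw [← AddCircle.coe_add, mapDeriv_coe hF.continuous hlift]
  have hd : Differentiable ℝ (deriv F) := (contDiff_deriv_of_contDiff_two hF).differentiable (by norm_num)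
  have : DifferentiableAt ℝ (fun s => deriv F (t + s)) 0 := by fun_prop
  exact e ▸ this

theorem IsC2.dilation_pos (hT : IsC2 T) (h0 : ∀ x, mapDeriv T x ≠ 0) : 0 < dilation T := by
  obtain ⟨x, -, hx⟩ := isCompact_univ.exists_isMinOn Set.univ_nonempty
    hT.continuous_mapDeriv.abs.continuousOn
  refine (abs_pos.2 (h0 x)).trans_le (le_ciInf fun y => hx (Set.mem_univ y))

theorem IsC2.hasBounds (hT : IsC2 T) (h0 : ∀ x, mapDeriv T x ≠ 0) :
    HasBounds T (dilation T)⁻¹ (distortion T) (⨆ x, |mapDeriv T x|) := by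
  have hpos := hT.dilation_pos h0
  have hc := hT.continuous_mapDeriv
  have hc2 : Continuous fun x => |mapDeriv2 T x / mapDeriv T x ^ 2| :=
    (hT.continuous_mapDeriv2.div (hc.pow 2) fun x => pow_ne_zero 2 (h0 x)).abs
  obtain ⟨F, hF, hlift⟩ := id hT
  refine ⟨F, hF, hlift, fun t => ?_⟩
  rw [← mapDeriv2_coe hF.continuous hlift, ← mapDeriv_coe hF.continuous hlift]
  refine ⟨h0 _, ?_, ?_, le_ciSup (bddAbove_range_of_continuous hc.abs) _⟩
  · exact inv_anti₀ hpos (ciInf_le (bddBelow_range_of_continuous hc.abs) _)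
  · have h1 : |mapDeriv2 T (t : UnitAddCircle) / mapDeriv T (t : UnitAddCircle) ^ 2| ≤
        distortion T := le_ciSup (bddAbove_range_of_continuous hc2) (t : UnitAddCircle)
    have h2 : 0 < mapDeriv T (t : UnitAddCircle) ^ 2 := by
      have := h0 (t : UnitAddCircle)
      positivity
    rwa [abs_div, abs_of_pos h2, div_le_iff₀ h2] at h1

end Lift

section System

variable {Ω : Type*} [MeasurableSpace Ω] {η : Measure Ω} {T : Ω → UnitAddCircle → UnitAddCircle}

theorem measurable_mapDeriv (hm : Measurable fun p : Ω × UnitAddCircle => T p.1 p.2)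
    (h0 : ∀ ω x, mapDeriv (T ω) x ≠ 0) (x : UnitAddCircle) :
    Measurable fun ω => mapDeriv (T ω) x := by
  have hmx : ∀ y, Measurable fun ω => T ω y := fun y => hm.comp measurable_prodMk_right
  -- `deriv` is `0` where the derivative fails to exist, so nonvanishing already gives
  -- differentiability.
  exact measurable_deriv_zero (fun ω => differentiableAt_of_deriv_ne_zero (h0 ω x))
    fun s => measurable_rep.comp ((hmx _).sub (hmx _))

theorem measurable_mapDeriv2 (hm : Measurable fun p : Ω × UnitAddCircle => T p.1 p.2)
    (hC2 : ∀ ω, IsC2 (T ω)) (h0 : ∀ ω x, mapDeriv (T ω) x ≠ 0) (x : UnitAddCircle) :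
    Measurable fun ω => mapDeriv2 (T ω) x :=
  measurable_deriv_zero (fun ω => (hC2 ω).differentiableAt_mapDeriv x)
    fun _ => measurable_mapDeriv hm h0 _

theorem systemBounds (hm : Measurable fun p : Ω × UnitAddCircle => T p.1 p.2)
    (hC2 : ∀ ω, IsC2 (T ω)) (h0 : ∀ ω x, mapDeriv (T ω) x ≠ 0)
    (hl : ∫⁻ ω, ENNReal.ofReal ((dilation (T ω) ^ 2)⁻¹) ∂η < ∞)
    (hD : ∫⁻ ω, ENNReal.ofReal (distortion (T ω) ^ 2) ∂η < ∞) :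
    SystemBounds η T (fun ω => (dilation (T ω))⁻¹) (fun ω => distortion (T ω))
      (fun ω => ⨆ x, |mapDeriv (T ω) x|) := by
  have hc := fun ω => (hC2 ω).continuous_mapDeriv
  have m1 : Measurable fun ω => dilation (T ω) :=
    measurable_iInf_of_continuous (fun ω => (hc ω).abs) fun x => (measurable_mapDeriv hm h0 x).abs
  have m2 : Measurable fun ω => distortion (T ω) :=
    measurable_iSup_of_continuous
      (fun ω => ((hC2 ω).continuous_mapDeriv2.div ((hc ω).pow 2) fun x => pow_ne_zero 2 (h0 ω x)).abs)
      fun x => ((measurable_mapDeriv2 hm hC2 h0 x).div ((measurable_mapDeriv hm h0 x).pow_const 2)).abs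
  refine ⟨hm, fun ω => (hC2 ω).hasBounds (h0 ω), m1.inv, m2,
    measurable_iSup_of_continuous (fun ω => (hc ω).abs) fun x => (measurable_mapDeriv hm h0 x).abs,
    ⟨(m1.inv.pow_const 2).aestronglyMeasurable, ?_⟩,
    ⟨(m2.pow_const 2).aestronglyMeasurable, ?_⟩⟩
  · rw [hasFiniteIntegral_iff_ofReal (Filter.Eventually.of_forall fun ω => sq_nonneg _)]
    simpa only [inv_pow] using hl
  · rwa [hasFiniteIntegral_iff_ofReal (Filter.Eventually.of_forall fun ω => sq_nonneg _)]

theorem integral_inv_dilation_sq_lt_one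
    (h : SystemBounds η T (fun ω => (dilation (T ω))⁻¹) (fun ω => distortion (T ω))
      (fun ω => ⨆ x, |mapDeriv (T ω) x|))
    (hl : ∫⁻ ω, ENNReal.ofReal ((dilation (T ω) ^ 2)⁻¹) ∂η < 1) :
    ∫ ω, (dilation (T ω))⁻¹ ^ 2 ∂η < 1 := by
  rw [integral_eq_lintegral_of_nonneg_ae (Filter.Eventually.of_forall fun ω => sq_nonneg _)
    h.integrable_l.1]
  simp only [inv_pow]
  exact (ENNReal.toReal_lt_of_lt_ofReal (by simpa using hl))

end System

/-! ### Hölder observables, `L^∞` observables and correlations -/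

section Holder

variable {E : Type*} [NormedAddCommGroup E] {α : ℝ≥0} {f : UnitAddCircle → E}

theorem norm_sub_le_of_memHolder (hf : MemHolder α f) (x y : UnitAddCircle) :
    ‖f x - f y‖ ≤ nnHolderNorm α f * dist x y ^ (α : ℝ) := by
  rw [← dist_eq_norm]
  exact hf.holderWith.dist_le x y

theorem continuous_of_memHolder (hα : 0 < α) (hf : MemHolder α f) : Continuous f :=
  hf.holderWith.continuous hα

theorem norm_le_iSup_of_memHolder (hα : 0 < α) (hf : MemHolder α f) (x : UnitAddCircle) :
    ‖f x‖ ≤ ⨆ y, ‖f y‖ :=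
  le_ciSup (bddAbove_range_of_continuous (continuous_of_memHolder hα hf).norm) x

end Holder

theorem dist_le_rpow {α : ℝ} (hα1 : α ≤ 1) (x y : UnitAddCircle) :
    dist x y ≤ dist x y ^ α := by
  rcases (dist_nonneg (x := x) (y := y)).eq_or_lt with h | h
  · rw [← h]
    exact Real.rpow_nonneg le_rfl _
  · simpa using Real.rpow_le_rpow_of_exponent_ge h (dist_le_one x y) hα1

theorem IsLipDensity.le_add_one {A : ℝ} (hA : 0 ≤ A) {φ : C(UnitAddCircle, ℝ)}
    (hφ : IsLipDensity A φ) (x : UnitAddCircle) : |φ x| ≤ A + 1 := by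
  have h := hφ.isLip.abs_le hA one_pos le_rfl x
  simp_rw [fun y => abs_of_nonneg (hφ.nonneg y)] at h
  rw [abs_of_nonneg (hφ.nonneg x)]
  rw [hφ.integral_eq] at h
  simpa using h

theorem IsLipDensity.mul_holder {A : ℝ} (hA : 0 ≤ A) {φ a : C(UnitAddCircle, ℝ)}
    (hφ : IsLipDensity A φ) {H S α : ℝ} (hα1 : α ≤ 1)
    (ha : ∀ x y, |a x - a y| ≤ H * dist x y ^ α) (hS : ∀ x, |a x| ≤ S) (x y : UnitAddCircle) :
    |(a * φ) x - (a * φ) y| ≤ (S * A + (A + 1) * H) * dist x y ^ α := by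
  have hS0 : 0 ≤ S := (abs_nonneg _).trans (hS 0)
  have e : (a * φ) x - (a * φ) y = a x * (φ x - φ y) + φ y * (a x - a y) := by
    simp only [ContinuousMap.mul_apply]
    ring
  rw [e, add_mul]
  refine (abs_add_le _ _).trans (add_le_add ?_ ?_)
  · rw [abs_mul, mul_assoc]
    exact mul_le_mul (hS x) ((hφ.isLip x y).trans
      (mul_le_mul_of_nonneg_left (dist_le_rpow hα1 x y) hA)) (abs_nonneg _) hS0
  · rw [abs_mul, mul_assoc]
    exact mul_le_mul (hφ.le_add_one hA y) (ha x y) (abs_nonneg _) (by linarith)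

/-- The Markov operator acts pointwise, so an essentially bounded function is first replaced by a
strongly measurable version that obeys the bound everywhere. -/
theorem exists_bounded_ae_eq {g : UnitAddCircle → ℂ} (hg : MemLp g ∞ volume) :
    ∃ g' : UnitAddCircle → ℂ, StronglyMeasurable g' ∧
      (∀ x, ‖g' x‖ ≤ (eLpNorm g ∞ volume).toReal) ∧ g =ᵐ[volume] g' := by
  set B := (eLpNorm g ∞ volume).toReal
  have hm := hg.1.stronglyMeasurable_mk
  set s : Set UnitAddCircle := {x | ‖hg.1.mk g x‖ ≤ B}
  have hs : MeasurableSet s := measurableSet_le hm.norm.measurable measurable_const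
  refine ⟨s.indicator (hg.1.mk g), hm.indicator hs, fun x => ?_, ?_⟩
  · by_cases hx : x ∈ s
    · rw [Set.indicator_of_mem hx]
      exact hx
    · rw [Set.indicator_of_notMem hx, norm_zero]
      exact ENNReal.toReal_nonneg
  · filter_upwards [hg.1.ae_eq_mk, ae_le_eLpNormEssSup (f := g)] with x h1 h2
    have : x ∈ s := by
      change ‖hg.1.mk g x‖ ≤ B
      rw [← h1, ← toReal_enorm]
      rw [← eLpNorm_exponent_top] at h2
      exact ENNReal.toReal_mono hg.2.ne h2
    rw [Set.indicator_of_mem this, h1]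

namespace SystemBounds

variable {Ω : Type*} [MeasurableSpace Ω] {η : Measure Ω} [IsProbabilityMeasure η]
  {T : Ω → UnitAddCircle → UnitAddCircle} {l D M : Ω → ℝ}
  {E : Type*} [NormedAddCommGroup E] [NormedSpace ℝ E]

theorem quasiMeasurePreserving_map (h : SystemBounds η T l D M) :
    Measure.QuasiMeasurePreserving (fun p : Ω × UnitAddCircle => T p.1 p.2) (η.prod volume)
      volume := by
  refine ⟨h.measurable_map, ?_⟩
  have := h.map_prod_withDensity (g := 1) fun x => zero_le_one
  simp only [ContinuousMap.one_apply, ENNReal.ofReal_one, withDensity_const, one_smul] at this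
  rw [this]
  exact withDensity_absolutelyContinuous _ _

/-- The law of `T_ω x` under `η × volume` is absolutely continuous, so null sets of the circle stay
invisible to the Markov operator. -/
theorem markovOp_ae_eq (h : SystemBounds η T l D M) {f g : UnitAddCircle → E}
    (hfg : f =ᵐ[volume] g) : markovOp η T f =ᵐ[volume] markovOp η T g := by
  have h1 := h.quasiMeasurePreserving_map.ae hfg
  have h2 := (Measure.measurePreserving_swap (μ := (volume : Measure UnitAddCircle))
    (ν := η)).quasiMeasurePreserving.ae h1
  filter_upwards [Measure.ae_ae_of_ae_prod h2] with x hx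
  exact integral_congr_ae hx

theorem markovOp_iterate_ae_eq (h : SystemBounds η T l D M) {f g : UnitAddCircle → E}
    (hfg : f =ᵐ[volume] g) (n : ℕ) :
    (markovOp η T)^[n] f =ᵐ[volume] (markovOp η T)^[n] g := by
  induction n with
  | zero => exact hfg
  | succ n ih =>
    rw [Function.iterate_succ_apply', Function.iterate_succ_apply']
    exact h.markovOp_ae_eq ih

theorem norm_integral_smul_iterate_sub_le (h : SystemBounds η T l D M) {g : UnitAddCircle → E}
    {B : ℝ} (hg : StronglyMeasurable g) (hB : ∀ x, ‖g x‖ ≤ B) (ψ φ : C(UnitAddCircle, ℝ)) (n : ℕ) :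
    ‖(∫ x, ψ x • (markovOp η T)^[n] g x) - (∫ x, ψ x) • ∫ x, φ x • g x‖ ≤
      B * ∫ x, |(h.op ^ n) ψ x - (∫ y, ψ y) * φ x| := by
  have hi : Integrable fun x => (∫ y, ψ y) • φ x • g x :=
    (integrable_smul_of_bounded φ hg hB).smul _
  rw [← h.integral_op_pow_smul hg hB, ← integral_smul, ← integral_sub
    (integrable_smul_of_bounded _ hg hB) hi,
    ← integral_const_mul]
  refine norm_integral_le_of_norm_le
    ((integrable_abs_coe ((h.op ^ n) ψ - (∫ y, ψ y) • φ)).const_mul B)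
    (Filter.Eventually.of_forall fun x => ?_)
  rw [smul_smul, ← sub_smul, norm_smul, mul_comm, Real.norm_eq_abs]
  exact mul_le_mul_of_nonneg_right (hB x) (abs_nonneg _)

theorem isStationary (h : SystemBounds η T l D M) {φ : C(UnitAddCircle, ℝ)} (hφ : h.op φ = φ)
    (h0 : ∀ x, 0 ≤ φ x) :
    IsStationary η T (volume.withDensity fun x => ENNReal.ofReal (φ x)) := by
  rintro f hf ⟨B, hB⟩
  rw [integral_withDensity_ofReal φ.continuous h0, integral_withDensity_ofReal φ.continuous h0,
    ← h.integral_op_smul hf.stronglyMeasurable hB, hφ]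

end SystemBounds

theorem isProbabilityMeasure_withDensity {A : ℝ} {φ : C(UnitAddCircle, ℝ)}
    (hφ : IsLipDensity A φ) :
    IsProbabilityMeasure
      ((volume : Measure UnitAddCircle).withDensity fun x => ENNReal.ofReal (φ x)) := by
  refine ⟨?_⟩
  rw [withDensity_apply _ MeasurableSet.univ, Measure.restrict_univ,
    ← ofReal_integral_eq_lintegral_ofReal (integrable_coe φ)
      (Filter.Eventually.of_forall hφ.nonneg), hφ.integral_eq, ENNReal.ofReal_one]

theorem eLpNorm_one_coe (g : C(UnitAddCircle, ℝ)) :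
    eLpNorm g 1 volume = ENNReal.ofReal (∫ x, |g x|) := by
  rw [eLpNorm_one_eq_lintegral_enorm, ← ofReal_integral_norm_eq_lintegral_enorm (integrable_coe g)]
  rfl

theorem integral_ofReal_add_I_mul (u v : C(UnitAddCircle, ℝ)) :
    ∫ x, ((u x : ℂ) + Complex.I * (v x : ℂ)) =
      ((∫ x, u x : ℝ) : ℂ) + Complex.I * ((∫ x, v x : ℝ) : ℂ) := by
  have hu : Integrable fun x => (u x : ℂ) := (integrable_coe u).ofReal
  have hv : Integrable fun x => (v x : ℂ) := (integrable_coe v).ofReal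
  rw [integral_add hu (hv.const_mul _), integral_const_mul, integral_complex_ofReal,
    integral_complex_ofReal]

/-- Decay of correlations for the density `φ`, given the decay of the transfer operator on
real-valued Hölder functions. -/
theorem SystemBounds.norm_correlation_le {Ω : Type*} [MeasurableSpace Ω] {η : Measure Ω}
    [IsProbabilityMeasure η] {T : Ω → UnitAddCircle → UnitAddCircle} {l D M : Ω → ℝ}
    (h : SystemBounds η T l D M) {A C R α : ℝ} (hA : 0 ≤ A) {φ : C(UnitAddCircle, ℝ)}
    (hφ : IsLipDensity A φ) (hC : 0 ≤ C) (hR : 0 ≤ R) (hα1 : α ≤ 1) {n : ℕ}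
    (hdecay : ∀ (ψ : C(UnitAddCircle, ℝ)) (H S : ℝ), 0 ≤ H →
      (∀ x y, |ψ x - ψ y| ≤ H * dist x y ^ α) → (∀ x, |ψ x| ≤ S) →
      ∫ x, |(h.op ^ n) ψ x - (∫ y, ψ y) * φ x| ≤ C * (H + S) * R)
    {f g : UnitAddCircle → ℂ} {H S : ℝ} (hH : 0 ≤ H) (hfc : Continuous f)
    (hf : ∀ x y, ‖f x - f y‖ ≤ H * dist x y ^ α) (hfS : ∀ x, ‖f x‖ ≤ S)
    (hg : MemLp g ∞ volume) :
    ‖∫ x, f x * (markovOp η T)^[n] g x ∂(volume.withDensity fun x => ENNReal.ofReal (φ x))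
        - (∫ x, f x ∂(volume.withDensity fun x => ENNReal.ofReal (φ x))) *
          ∫ x, g x ∂(volume.withDensity fun x => ENNReal.ofReal (φ x))‖ ≤
      2 * C * (2 * A + 1) * (H + S) * (eLpNorm g ∞ volume).toReal * R := by
  obtain ⟨g', hgm, hgB, hgg⟩ := exists_bounded_ae_eq hg
  set B := (eLpNorm g ∞ volume).toReal
  have hB0 : 0 ≤ B := ENNReal.toReal_nonneg
  have hS0 : 0 ≤ S := (norm_nonneg _).trans (hfS 0)
  set G := (markovOp η T)^[n] g'
  have hGm : StronglyMeasurable G := h.stronglyMeasurable_markovOp_iterate hgm n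
  have hGB : ∀ x, ‖G x‖ ≤ B := norm_markovOp_iterate_le T hgB n
  set a : C(UnitAddCircle, ℝ) := ⟨fun x => (f x).re, Complex.continuous_re.comp hfc⟩
  set b : C(UnitAddCircle, ℝ) := ⟨fun x => (f x).im, Complex.continuous_im.comp hfc⟩
  have hfab : ∀ x, f x = a x + Complex.I * b x := fun x => by
    rw [mul_comm]
    exact (Complex.re_add_im (f x)).symm
  -- For real `u`, duality moves the iterates onto `u φ`, which is again Hölder because `φ` is
  -- Lipschitz; the real and imaginary parts of `f` are treated separately, whence the factor `2`.
  have key : ∀ u : C(UnitAddCircle, ℝ), (∀ x y, |u x - u y| ≤ H * dist x y ^ α) →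
      (∀ x, |u x| ≤ S) →
      ‖(∫ x, (u * φ) x • G x) - (∫ x, (u * φ) x) • ∫ x, φ x • g' x‖ ≤
        C * (2 * A + 1) * (H + S) * B * R := fun u hu huS => by
    refine (h.norm_integral_smul_iterate_sub_le hgm hgB (u * φ) φ n).trans ?_
    have hS' : ∀ x, |(u * φ) x| ≤ S * (A + 1) := fun x => by
      rw [ContinuousMap.mul_apply, abs_mul]
      exact mul_le_mul (huS x) (hφ.le_add_one hA x) (abs_nonneg _) hS0
    have h1 := hdecay (u * φ) (S * A + (A + 1) * H) (S * (A + 1)) (by positivity)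
      (hφ.mul_holder hA hα1 hu huS) hS'
    calc _ ≤ B * (C * (S * A + (A + 1) * H + S * (A + 1)) * R) :=
          mul_le_mul_of_nonneg_left h1 hB0
      _ ≤ B * (C * ((2 * A + 1) * (H + S)) * R) := by
          gcongr
          nlinarith [mul_nonneg hA hH]
      _ = _ := by ring
  have ka := key a (fun x y => (Complex.abs_re_le_norm (f x - f y)).trans (hf x y))
    (fun x => (Complex.abs_re_le_norm (f x)).trans (hfS x))
  have kb := key b (fun x y => (Complex.abs_im_le_norm (f x - f y)).trans (hf x y))
    (fun x => (Complex.abs_im_le_norm (f x)).trans (hfS x))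
  have e1 : ∫ x, f x * (markovOp η T)^[n] g x ∂(volume.withDensity fun x => ENNReal.ofReal (φ x)) =
      (∫ x, (a * φ) x • G x) + Complex.I * ∫ x, (b * φ) x • G x := by
    rw [integral_withDensity_ofReal φ.continuous hφ.nonneg, ← integral_const_mul,
      ← integral_add (integrable_smul_of_bounded _ hGm hGB)
        ((integrable_smul_of_bounded _ hGm hGB).const_mul _)]
    refine integral_congr_ae ?_
    filter_upwards [h.markovOp_iterate_ae_eq hgg n] with x hx
    rw [hx, hfab x]
    simp only [ContinuousMap.mul_apply, Complex.real_smul, Complex.ofReal_mul]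
    ring
  have e2 : ∫ x, f x ∂(volume.withDensity fun x => ENNReal.ofReal (φ x)) =
      ((∫ x, (a * φ) x : ℝ) : ℂ) + Complex.I * ((∫ x, (b * φ) x : ℝ) : ℂ) := by
    rw [integral_withDensity_ofReal φ.continuous hφ.nonneg, ← integral_ofReal_add_I_mul]
    refine integral_congr_ae (Filter.Eventually.of_forall fun x => ?_)
    simp only [hfab x, ContinuousMap.mul_apply, Complex.real_smul, Complex.ofReal_mul]
    ring
  have e3 : ∫ x, g x ∂(volume.withDensity fun x => ENNReal.ofReal (φ x)) =
      ∫ x, φ x • g' x := by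
    rw [integral_withDensity_ofReal φ.continuous hφ.nonneg]
    refine integral_congr_ae ?_
    filter_upwards [hgg] with x hx
    rw [hx]
  rw [e1, e2, e3]
  have e4 : ∀ p q r s t : ℂ, p + Complex.I * q - (r + Complex.I * s) * t =
      (p - r * t) + Complex.I * (q - s * t) := fun p q r s t => by ring
  rw [e4]
  refine (norm_add_le _ _).trans ?_
  rw [norm_mul, Complex.norm_I, one_mul]
  rw [Complex.real_smul] at ka kb
  calc _ ≤ _ := add_le_add ka kb
    _ = _ := by ring

end RandomCircle

end

/-! ### The main theorem -/

theorem theorem3 {Ω : Type*} [MeasurableSpace Ω] (η : Measure Ω) [IsProbabilityMeasure η]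
    (T : Ω → UnitAddCircle → UnitAddCircle)
    (hT_meas : Measurable fun p : Ω × UnitAddCircle => T p.1 p.2)
    (hT_C2 : ∀ ω, RandomCircle.IsC2 (T ω))
    (hT_crit : ∀ ω x, RandomCircle.mapDeriv (T ω) x ≠ 0)
    (h_dilation : ∫⁻ ω, ENNReal.ofReal ((RandomCircle.dilation (T ω) ^ 2)⁻¹) ∂η < 1)
    (h_distortion : ∫⁻ ω, ENNReal.ofReal (RandomCircle.distortion (T ω) ^ 2) ∂η < ∞) :
    -- the stationary distribution `μ` and its Lipschitz density `φ`, bounded away from zero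
    ∃ (μ : Measure UnitAddCircle) (φ : UnitAddCircle → ℝ),
      IsProbabilityMeasure μ ∧ RandomCircle.IsStationary η T μ ∧
      μ = volume.withDensity (fun x => ENNReal.ofReal (φ x)) ∧
      (∃ K : ℝ≥0, LipschitzWith K φ) ∧ (∃ c : ℝ, 0 < c ∧ ∀ x, c ≤ φ x) ∧
      ∃ θ : ℝ, 0 < θ ∧ θ < 1 ∧ ∀ α : ℝ≥0, 0 < α → α < 1 → ∃ C : ℝ, 0 < C ∧
        -- convergence to the stationary density in `L¹`
        (∀ ψ : UnitAddCircle → ℝ, MemHolder α ψ → (∀ x, 0 ≤ ψ x) → (∫ x, ψ x) = 1 → ∀ n : ℕ,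
          eLpNorm (fun x => (RandomCircle.avgTransfer η T)^[n] ψ x - φ x) 1 volume ≤
            ENNReal.ofReal (C * RandomCircle.holderNorm α ψ * θ ^ ((α : ℝ) * (n : ℝ)))) ∧
        -- decay of pair correlations
        (∀ f g : UnitAddCircle → ℂ, MemHolder α f → MemLp g ∞ volume → ∀ n : ℕ,
          ‖∫ x, f x * (RandomCircle.markovOp η T)^[n] g x ∂μ
              - (∫ x, f x ∂μ) * ∫ x, g x ∂μ‖ ≤
            C * RandomCircle.holderNorm α f * (eLpNorm g ∞ volume).toReal
              * θ ^ ((α : ℝ) * (n : ℝ))) := by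
  have h := RandomCircle.systemBounds hT_meas hT_C2 hT_crit (h_dilation.trans ENNReal.one_lt_top) h_distortion
  obtain ⟨N, A, c, hP⟩ := h.exists_isDoeblin (RandomCircle.integral_inv_dilation_sq_lt_one h h_dilation)
  have hA : 0 ≤ A := zero_le_one.trans hP.one_le
  obtain ⟨φ, hPφ, hφ, hcφ⟩ := hP.exists_invariant
  obtain ⟨θ, hθ0, hθ1, C, hC, hdecay⟩ := hP.exists_holder_decay hPφ hφ
  refine ⟨volume.withDensity fun x => ENNReal.ofReal (φ x), φ,
    RandomCircle.isProbabilityMeasure_withDensity hφ, h.isStationary hPφ hφ.nonneg, rfl,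
    ⟨⟨A, hA⟩, LipschitzWith.of_dist_le_mul hφ.isLip⟩, ⟨c, hP.c_pos, hcφ⟩, θ, hθ0, hθ1,
    fun α hα0 hα1 => ⟨2 * C * (2 * A + 1), by positivity, fun ψ hψ hψ0 hψ1 n => ?_,
      fun f g hf hg n => ?_⟩⟩
  · set Ψ : C(UnitAddCircle, ℝ) := ⟨ψ, RandomCircle.continuous_of_memHolder hα0 hψ⟩
    have h1 := hdecay Ψ _ _ α (nnHolderNorm α ψ).2 hα0 hα1
      (RandomCircle.norm_sub_le_of_memHolder hψ) (RandomCircle.norm_le_iSup_of_memHolder hα0 hψ) n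
    rw [show ∫ y, Ψ y = 1 from hψ1] at h1
    have e : (fun x => (RandomCircle.avgTransfer η T)^[n] ψ x - φ x) = ⇑((h.op ^ n) Ψ - φ) := by
      ext x
      rw [ContinuousMap.sub_apply, h.coe_op_pow]
      rfl
    rw [e, RandomCircle.eLpNorm_one_coe]
    refine ENNReal.ofReal_le_ofReal ?_
    simp only [one_mul] at h1
    refine h1.trans ?_
    have hnn : 0 ≤ RandomCircle.holderNorm α ψ :=
      add_nonneg (nnHolderNorm α ψ).2 (Real.iSup_nonneg fun x => norm_nonneg _)
    change C * RandomCircle.holderNorm α ψ * _ ≤ _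
    -- The constant needed for correlations also serves the `L¹` estimate.
    have : C ≤ 2 * C * (2 * A + 1) := by nlinarith [mul_nonneg hC.le hA]
    gcongr
  · exact h.norm_correlation_le hA hφ hC.le (Real.rpow_nonneg hθ0.le _)
      (show (α : ℝ) ≤ 1 from hα1.le)
      (fun ψ H S hH hψ hS => hdecay ψ H S α hH hα0 hα1 hψ hS n) (nnHolderNorm α f).2
      (RandomCircle.continuous_of_memHolder hα0 hf) (RandomCircle.norm_sub_le_of_memHolder hf)
      (RandomCircle.norm_le_iSup_of_memHolder hα0 hf) hg
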